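/- Let $d\ge 1$ be an integer, $\tilde d=\lceil (d+1)/2\rceil$, and let $f\in\mathbb R[x]$ have degree $d$, parity $d \bmod 2$, and $\|f\|_\infty:=\max_{x\in[-1,1]}|f(x)|<1$. For $\Phi=(\phi_0,\dots,\phi_d)\in\mathbb R^{d+1}$ and $x\in[-1,1]$ put $$U(x,\Phi)=e^{\mathrm i\phi_0Z}\prod_{j=1}^{d}\left(e^{\mathrm i\arccos(x)X}e^{\mathrm i\phi_jZ}\right),\qquad g(x,\Phi)=\operatorname{Re}\,U(x,\Phi)_{11},$$ where the product is ordered from left to right, $X=\begin{pmatrix}0&1\\1&0\end{pmatrix}$ and $Z=\begin{pmatrix}1&0\\0&-1\end{pmatrix}$. Call $\Phi$ symmetric if $\phi_{d-j}=\phi_j$ for all $j$. A symmetric $\Phi$ is determined by its reduced phase factors $\tilde\Phi=(\phi_0,\dots,\phi_{\tilde d-1})\in\mathbb R^{\tilde d}$, and the cost function, viewed as a function of $\tilde\Phi\in\mathbb R^{\tilde d}$, is $$F(\tilde\Phi)=\frac1{\tilde d}\sum_{k=1}^{\tilde d}|g(x_k,\Phi)-f(x_k)|^2,\qquad x_k=\cos\left(\frac{2k-1}{4\tilde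 d}\pi\right).$$ Let $\mathrm{Hess}(\tilde\Phi)=\left(\partial_{\phi_i}\partial_{\phi_j}F(\tilde\Phi)\right)_{0\le i,j<\tilde d}$. Let $\mathfrak F(z)=1-f\left(\frac{z+z^{-1}}2\right)^2$, let $\mathcal D$ be the multiset of the roots of $\mathfrak F$ (with multiplicity) in the open unit disc, let $e(z)=z^{-d}\prod_{r\in\mathcal D}(z-r)$, and let $\alpha=(1-f(1)^2)/\prod_{r\in\mathcal D}(1-r)^2>0$, so that $\mathfrak F(z)=\alpha\, e(z)e(z^{-1})$. For $x\in[-1,1]$ and $z=x+\mathrm i\sqrt{1-x^2}$ put $$P(x)=f(x)+\mathrm i\sqrt\alpha\,\frac{e(z)+e(z^{-1})}{2},\qquad Q(x)=\sqrt\alpha\,\frac{e(z)-e(z^{-1})}{2\mathrm i\sqrt{1-x^2}}$$ (these are polynomials in $x$, and $Q(\pm1)$ is defined by continuity). Let $D_d$ be the set of $\Phi\in\mathbb R^{d+1}$ all of whose entries lie in $[-\frac\pi2,\frac\pi2)$, except that for even $d$ the middle entry $\phi_{d/2}$ is only required to lie in $[-\pi,\pi)$. The maximal solution for $f$ is the symmetric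 $\Phi^*\in D_d$ such that $$U(x,\Phi^*)=\begin{pmatrix}P(x)&\mathrm iQ(x)\sqrt{1-x^2}\\ \mathrm iQ(x)\sqrt{1-x^2}&\overline{P(x)}\end{pmatrix}\qquad\text{for all }x\in[-1,1].$$ **Theorem.** If $\|f\|_\infty\le\frac{\sqrt3}{20\pi\tilde d}$ and $\Phi^*$ is the maximal solution for $f$, with reduced phase factors $\tilde\Phi^*$, then $\mathrm{Hess}(\tilde\Phi^*)$ is positive definite and its smallest eigenvalue satisfies $\lambda_{\min}\left(\mathrm{Hess}(\tilde\Phi^*)\right)\ge\frac{32}{25}$. -/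

import Mathlib

open Polynomial

namespace SymQSP

noncomputable section

/-! ### Quantum signal processing -/

/-- The Pauli matrix `X`. -/
def pauliX : Matrix (Fin 2) (Fin 2) ℂ := !![0, 1; 1, 0]

/-- The Pauli matrix `Z`. -/
def pauliZ : Matrix (Fin 2) (Fin 2) ℂ := !![1, 0; 0, -1]

/-- `e^{i φ Z}` -/
def rotZ (φ : ℝ) : Matrix (Fin 2) (Fin 2) ℂ :=
  NormedSpace.exp ((Complex.I * (φ : ℂ)) • pauliZ)

/-- `W(x) = e^{i arccos(x) X}` -/
def signalW (x : ℝ) : Matrix (Fin 2) (Fin 2) ℂ :=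
  NormedSpace.exp ((Complex.I * (Real.arccos x : ℂ)) • pauliX)

/-- `U(x, Φ) = e^{i φ₀ Z} W(x) e^{i φ₁ Z} W(x) e^{i φ₂ Z} ⋯ W(x) e^{i φ_d Z}` -/
def qspU (d : ℕ) (x : ℝ) (Φ : Fin (d + 1) → ℝ) : Matrix (Fin 2) (Fin 2) ℂ :=
  rotZ (Φ 0) * (List.ofFn fun j : Fin d => signalW x * rotZ (Φ j.succ)).prod

/-- `g(x, Φ) = Re ⟨0|U(x, Φ)|0⟩` -/
def qspG (d : ℕ) (x : ℝ) (Φ : Fin (d + 1) → ℝ) : ℝ := (qspU d x Φ 0 0).re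

/-! ### Symmetric and reduced phase factors -/

/-- The number `d̃ = ⌈(d + 1) / 2⌉` of reduced phase factors. -/
def dTilde (d : ℕ) : ℕ := d / 2 + 1

/-- Symmetric phase factors: `φ_{d - j} = φ_j`. -/
def IsSymmetric {d : ℕ} (Φ : Fin (d + 1) → ℝ) : Prop := ∀ j, Φ j.rev = Φ j

/-- The left half `(φ₀, …, φ_{d̃ - 1})` of `Φ`. -/
def reduced {d : ℕ} (Φ : Fin (d + 1) → ℝ) : Fin (dTilde d) → ℝ :=
  fun i => Φ ⟨i, lt_of_lt_of_le i.2 (Nat.succ_le_succ (Nat.div_le_self d 2))⟩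

/-- The symmetric phase factors of length `d + 1` with the given left half. -/
def unfold {d : ℕ} (φ : Fin (dTilde d) → ℝ) : Fin (d + 1) → ℝ :=
  fun j => φ ⟨min (j : ℕ) (d - j), by unfold dTilde; omega⟩

/-- The domain `D_d`: every phase factor lies in `[-π/2, π/2)`, except the middle one (which
exists exactly for even `d`), which lies in `[-π, π)`. -/
def phaseDomain (d : ℕ) : Set (Fin (d + 1) → ℝ) :=
  {Φ | ∀ j : Fin (d + 1),
    if 2 * (j : ℕ) = d then Φ j ∈ Set.Ico (-Real.pi) Real.pi
    else Φ j ∈ Set.Ico (-(Real.pi / 2)) (Real.pi / 2)}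

/-! ### Target polynomial, cost function, Hessian -/

/-- `‖f‖_∞ = max_{x ∈ [-1, 1]} |f(x)|` -/
def supNorm (f : ℝ[X]) : ℝ := sSup ((fun x : ℝ => |f.eval x|) '' Set.Icc (-1) 1)

/-- Target polynomials of degree `d`. -/
structure IsTarget (d : ℕ) (f : ℝ[X]) : Prop where
  degree_eq : f.degree = d
  parity : ∀ x : ℝ, f.eval (-x) = (-1) ^ d * f.eval x
  supNorm_lt : supNorm f < 1

/-- The nodes `x_k = cos((2k - 1)π / (4 d̃))`. -/
def node (d k : ℕ) : ℝ := Real.cos ((2 * (k : ℝ) - 1) / (4 * (dTilde d : ℝ)) * Real.pi)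

/-- The cost function `F`, as a function of the reduced phase factors. -/
def cost (d : ℕ) (f : ℝ[X]) (φ : Fin (dTilde d) → ℝ) : ℝ :=
  1 / (dTilde d : ℝ) *
    ∑ k ∈ Finset.Icc 1 (dTilde d), |qspG d (node d k) (unfold φ) - f.eval (node d k)| ^ 2

/-- The matrix of second partial derivatives `∂_j ∂_i F` at `φ`. -/
def hessian {n : ℕ} (F : (Fin n → ℝ) → ℝ) (φ : Fin n → ℝ) : Matrix (Fin n) (Fin n) ℝ :=
  Matrix.of fun i j =>
    lineDeriv ℝ (fun ψ => lineDeriv ℝ F ψ (Pi.single i 1)) φ (Pi.single j 1)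

/-- The smallest eigenvalue of a real symmetric matrix (of size `n ≥ 1`). -/
def lambdaMin {n : ℕ} {A : Matrix (Fin n) (Fin n) ℝ} (hA : A.IsHermitian) : ℝ :=
  ⨅ i, hA.eigenvalues i

/-! ### The maximal solution -/

/-- The polynomial `z^d f((z + z⁻¹)/2) = ∑ⱼ 𝐟ⱼ 2^{-j} z^{d - j} (z² + 1)^j`,
where `f = ∑ⱼ 𝐟ⱼ x^j` has degree at most `d`. -/
def joukowski (d : ℕ) (f : ℝ[X]) : ℂ[X] :=
  ∑ j ∈ Finset.range (d + 1),
    C ((f.coeff j : ℂ) / 2 ^ j) * X ^ (d - j) * (X ^ 2 + 1) ^ j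

/-- The polynomial `z^{2d} 𝔉(z)`, where `𝔉(z) = 1 - f((z + z⁻¹)/2)²`. For `f` of degree
`d ≥ 1` it does not vanish at `0`, so its roots are the roots of `𝔉`, with multiplicity. -/
def laurentPoly (d : ℕ) (f : ℝ[X]) : ℂ[X] := X ^ (2 * d) - joukowski d f ^ 2

/-- The multiset `𝒟` of the roots of `𝔉` in the open unit disc, with multiplicity. -/
def innerRoots (d : ℕ) (f : ℝ[X]) : Multiset ℂ :=
  open Classical in (laurentPoly d f).roots.filter fun r => ‖r‖ < 1

/-- `e(z) = z^{-d} ∏_{r ∈ 𝒟} (z - r)` -/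
def eFun (d : ℕ) (f : ℝ[X]) (z : ℂ) : ℂ :=
  (z ^ d)⁻¹ * ((innerRoots d f).map fun r => z - r).prod

/-- The constant `α > 0` with `𝔉(z) = α e(z) e(z⁻¹)`; evaluation at `z = 1` gives
`α = (1 - f(1)²) / ∏_{r ∈ 𝒟} (1 - r)²`. The quotient is real, as `𝒟` is closed under complex
conjugation. -/
def alpha (d : ℕ) (f : ℝ[X]) : ℝ :=
  ((1 - ((f.eval 1 : ℝ) : ℂ) ^ 2) / ((innerRoots d f).map fun r => (1 - r) ^ 2).prod).re

/-- `x + i √(1 - x²)`; its inverse is `x - i √(1 - x²)` for `x ∈ [-1, 1]`. -/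
def circlePt (x : ℝ) : ℂ := x + Complex.I * (√(1 - x ^ 2) : ℝ)

/-- The complementary polynomial `P_Im`, as a function on `[-1, 1]`. -/
def maxPIm (d : ℕ) (f : ℝ[X]) (x : ℝ) : ℂ :=
  (√(alpha d f) : ℝ) * (eFun d f (circlePt x) + eFun d f (circlePt x)⁻¹) / 2

/-- The complementary polynomial `Q`, as a function on `(-1, 1)`. (At `x = ±1` it is only used
multiplied by `√(1 - x²) = 0`.) -/
def maxQ (d : ℕ) (f : ℝ[X]) (x : ℝ) : ℂ :=
  (√(alpha d f) : ℝ) * (eFun d f (circlePt x) - eFun d f (circlePt x)⁻¹) /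
    (2 * Complex.I * (√(1 - x ^ 2) : ℝ))

/-- `P = f + i P_Im` on `[-1, 1]`. -/
def maxP (d : ℕ) (f : ℝ[X]) (x : ℝ) : ℂ := ((f.eval x : ℝ) : ℂ) + Complex.I * maxPIm d f x

/-- `Φ` is the maximal solution for `f`: the symmetric phase factors in `D_d` that represent the
pair `(P, Q)` built from the roots of `𝔉` in the unit disc. -/
structure IsMaximalSolution (d : ℕ) (f : ℝ[X]) (Φ : Fin (d + 1) → ℝ) : Prop where
  symm : IsSymmetric Φ
  mem_domain : Φ ∈ phaseDomain d
  qspU_eq : ∀ x ∈ Set.Icc (-1 : ℝ) 1, qspU d x Φ =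
    !![maxP d f x, Complex.I * maxQ d f x * (√(1 - x ^ 2) : ℝ);
       Complex.I * maxQ d f x * (√(1 - x ^ 2) : ℝ), star (maxP d f x)]

/-! ### Consistency of the definitions -/

theorem dTilde_eq_ceil (d : ℕ) : dTilde d = ⌈((d : ℝ) + 1) / 2⌉₊ := by
  unfold dTilde
  symm
  rw [Nat.ceil_eq_iff (by omega)]
  have h : d = 2 * (d / 2) + d % 2 := by omega
  have h2 : d % 2 ≤ 1 := by omega
  have h3 : (d : ℝ) = 2 * ((d / 2 : ℕ) : ℝ) + ((d % 2 : ℕ) : ℝ) := by exact_mod_cast h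
  have h4 : ((d % 2 : ℕ) : ℝ) ≤ 1 := by exact_mod_cast h2
  have h5 : (0 : ℝ) ≤ ((d % 2 : ℕ) : ℝ) := by positivity
  rw [Nat.add_sub_cancel]
  push_cast
  constructor <;> linarith

theorem unfold_reduced {d : ℕ} {Φ : Fin (d + 1) → ℝ} (h : IsSymmetric Φ) :
    unfold (reduced Φ) = Φ := by
  funext j
  have hj := j.2
  rcases le_total (j : ℕ) (d - j) with h1 | h1
  · simp only [unfold, reduced]
    congr 1
    ext
    simpa using h1
  · rw [← h j]
    simp only [unfold, reduced]
    congr 1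
    ext
    simp only [Fin.val_rev, min_eq_right h1]
    omega

theorem rotZ_eq (φ : ℝ) :
    rotZ φ = !![Complex.exp (Complex.I * φ), 0; 0, Complex.exp (-(Complex.I * φ))] := by
  have h : (Complex.I * (φ : ℂ)) • pauliZ =
      Matrix.diagonal ![Complex.I * φ, -(Complex.I * φ)] := by
    ext i j
    fin_cases i <;> fin_cases j <;> simp [pauliZ]
  rw [rotZ, h, Matrix.exp_diagonal]
  ext i j
  fin_cases i <;> fin_cases j <;> simp [Pi.coe_exp, Complex.exp_eq_exp_ℂ]

theorem signalW_eq (x : ℝ) (hx : x ∈ Set.Icc (-1 : ℝ) 1) :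
    signalW x = !![(x : ℂ), Complex.I * (√(1 - x ^ 2) : ℝ);
      Complex.I * (√(1 - x ^ 2) : ℝ), (x : ℂ)] := by
  set θ : ℂ := (Real.arccos x : ℂ) with hθ
  let H : Matrix (Fin 2) (Fin 2) ℂ := !![1, 1; 1, -1]
  let K : Matrix (Fin 2) (Fin 2) ℂ := !![1 / 2, 1 / 2; 1 / 2, -(1 / 2)]
  have hdiag : ∀ v : Fin 2 → ℂ, Matrix.diagonal v = !![v 0, 0; 0, v 1] := by
    intro v
    ext i j
    fin_cases i <;> fin_cases j <;> simp
  have hHK : H * K = 1 := by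
    ext i j
    fin_cases i <;> fin_cases j <;> simp [H, K, Matrix.mul_apply, Fin.sum_univ_two] <;> norm_num
  have hinv : H⁻¹ = K := Matrix.inv_eq_right_inv hHK
  have hunit : IsUnit H := IsUnit.of_mul_eq_one K hHK
  have h : (Complex.I * θ) • pauliX =
      H * Matrix.diagonal ![Complex.I * θ, -(Complex.I * θ)] * H⁻¹ := by
    rw [hinv, hdiag]
    ext i j
    fin_cases i <;> fin_cases j <;>
      simp [H, K, pauliX, Matrix.mul_apply, Fin.sum_univ_two] <;> ring
  have hc : Complex.cos θ = x := by
    rw [hθ, ← Complex.ofReal_cos, Real.cos_arccos hx.1 hx.2]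
  have hs : Complex.sin θ = (√(1 - x ^ 2) : ℝ) := by
    rw [hθ, ← Complex.ofReal_sin, Real.sin_arccos]
  have hp : NormedSpace.exp (Complex.I * θ) = x + Complex.I * (√(1 - x ^ 2) : ℝ) := by
    rw [← Complex.exp_eq_exp_ℂ, mul_comm, Complex.exp_mul_I, hc, hs]
    ring
  have hm : NormedSpace.exp (-(Complex.I * θ)) = x - Complex.I * (√(1 - x ^ 2) : ℝ) := by
    rw [← Complex.exp_eq_exp_ℂ, mul_comm, ← neg_mul, Complex.exp_mul_I, Complex.cos_neg,
      Complex.sin_neg, hc, hs]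
    ring
  rw [signalW, h, Matrix.exp_conj _ _ hunit, Matrix.exp_diagonal, hinv, hdiag]
  ext i j
  fin_cases i <;> fin_cases j <;>
    simp [H, K, Matrix.mul_apply, Fin.sum_univ_two, Pi.coe_exp, hp, hm] <;> ring

theorem eval_laurentPoly (d : ℕ) (f : ℝ[X]) (hf : f.natDegree ≤ d) (z : ℂ) (hz : z ≠ 0) :
    (laurentPoly d f).eval z =
      z ^ (2 * d) * (1 - ((f.map (algebraMap ℝ ℂ)).eval ((z + z⁻¹) / 2)) ^ 2) := by
  have h : (joukowski d f).eval z = z ^ d * (f.map (algebraMap ℝ ℂ)).eval ((z + z⁻¹) / 2) := by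
    rw [eval_eq_sum_range' (n := d + 1)
      (lt_of_le_of_lt natDegree_map_le (Nat.lt_succ_of_le hf)), joukowski, eval_finsetSum,
      Finset.mul_sum]
    refine Finset.sum_congr rfl fun j hj => ?_
    have hjd : j ≤ d := Nat.lt_succ_iff.mp (Finset.mem_range.mp hj)
    have h1 : z ^ d = z ^ (d - j) * z ^ j := by rw [← pow_add, Nat.sub_add_cancel hjd]
    have h2 : z ^ 2 + 1 = z * (z + z⁻¹) := by field_simp
    simp only [eval_mul, eval_C, eval_pow, eval_X, eval_add, eval_one, coeff_map,
      Complex.coe_algebraMap]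
    rw [h1, h2, mul_pow, div_pow]
    ring
  rw [laurentPoly, eval_sub, eval_pow, eval_pow, eval_X, h]
  ring

end

end SymQSP

namespace SymQSP

/-! At `Φ*` every residual `g(x_k) - f(x_k)` vanishes, so with `N = d̃` the Hessian is the
Gauss–Newton matrix `(2/N) JᵀJ`, and it suffices to bound the gradient of `g` at the nodes from
below (`dotProduct_hessian_cost`).

Differentiating `U` in `φ_j` amounts to replacing `φ_j` by `φ_j + π/2`. Hence all partial
derivatives of `g` are values of `g`, bounded by 1 by unitarity, and the gradient is Lipschitz in
the phases. At `(π/4, 0, …, 0, π/4)` the partial derivatives are `-cos((d - 2j)θ)`; discrete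
orthogonality gives their quadratic form exactly (`sum_sq_cos_nodes`). A perturbation with `(d+1)²
‖Φ - base‖² ≤ 1/25` still leaves 16/25 of it (`sum_sq_gradient_ge`).

It remains to show that `Φ*` is that close. Conjugated by the Hadamard matrix and multiplied by
`z^d`, `U` becomes a polynomial matrix in `z` whose constant terms factor into sines and cosines of
the phases. Comparison with the root products gives `∏ cos(Φ_j - base_j) = √α`
(`prod_cos_sub_basePhase`). The maximum principle gives `α ≥ 1 - ‖f‖²` (`le_sqrt_alpha`), while
`cos²x (1 + x²) ≤ 1` turns the product into `α (1 + ∑ (Φ_j - base_j)²) ≤ 1`. So the squared distance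
is `O(‖f‖²)`, and `‖f‖ = O(1/d̃)` suffices. -/

/-! ### Recursion and unitarity. -/

theorem qspU_zero (x : ℝ) (Φ : Fin 1 → ℝ) : qspU 0 x Φ = rotZ (Φ 0) := by
  simp [qspU]

theorem qspU_succ (d : ℕ) (x : ℝ) (Φ : Fin (d + 2) → ℝ) :
    qspU (d + 1) x Φ = rotZ (Φ 0) * signalW x * qspU d x (fun j => Φ j.succ) := by
  simp [qspU, List.ofFn_succ, mul_assoc]

theorem rotZ_mem_unitary (φ : ℝ) : rotZ φ ∈ Matrix.unitaryGroup (Fin 2) ℂ := by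
  have h : ∀ t : ℂ, Complex.exp (-t) * Complex.exp t = 1 := fun t => by
    rw [← Complex.exp_add]; simp
  rw [Matrix.mem_unitaryGroup_iff', rotZ_eq]
  ext i j
  fin_cases i <;> fin_cases j <;>
    simp [Matrix.mul_apply, Matrix.star_apply, Fin.sum_univ_two, ← Complex.exp_conj, h,
      ← Complex.exp_add]

theorem signalW_mem_unitary (x : ℝ) (hx : x ∈ Set.Icc (-1 : ℝ) 1) :
    signalW x ∈ Matrix.unitaryGroup (Fin 2) ℂ := by
  have h0 : 0 ≤ 1 - x ^ 2 := by nlinarith [hx.1, hx.2]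
  have h : ((√(1 - x ^ 2) : ℝ) : ℂ) * (√(1 - x ^ 2) : ℝ) = 1 - x ^ 2 := by
    rw [← Complex.ofReal_mul, Real.mul_self_sqrt h0]; push_cast; rfl
  rw [Matrix.mem_unitaryGroup_iff', signalW_eq x hx]
  generalize (√(1 - x ^ 2) : ℝ) = s at h
  ext i j
  fin_cases i <;> fin_cases j <;>
    simp [Matrix.mul_apply, Matrix.star_apply, Fin.sum_univ_two] <;>
    ring_nf <;> simp [Complex.I_sq] <;> linear_combination h

theorem qspU_mem_unitary (d : ℕ) (x : ℝ) (hx : x ∈ Set.Icc (-1 : ℝ) 1) (Φ : Fin (d + 1) → ℝ) :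
    qspU d x Φ ∈ Matrix.unitaryGroup (Fin 2) ℂ := by
  induction d with
  | zero => rw [qspU_zero]; exact rotZ_mem_unitary _
  | succ d ih =>
    rw [qspU_succ]
    exact mul_mem (mul_mem (rotZ_mem_unitary _) (signalW_mem_unitary x hx)) (ih _)

theorem abs_qspG_le_one (d : ℕ) (x : ℝ) (hx : x ∈ Set.Icc (-1 : ℝ) 1) (Φ : Fin (d + 1) → ℝ) :
    |qspG d x Φ| ≤ 1 :=
  (Complex.abs_re_le_norm _).trans (entry_norm_bound_of_unitary (qspU_mem_unitary d x hx Φ) 0 0)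

/-! ### Derivatives in the phase factors -/

/-- Because `e^{iπZ/2} = iZ`, differentiation in the phase is a shift by `π/2`. -/
theorem hasDerivAt_rotZ {γ : ℝ → ℝ} {γ' t : ℝ} (h : HasDerivAt γ γ' t) (i k : Fin 2) :
    HasDerivAt (fun s => rotZ (γ s) i k) ((γ' : ℂ) * rotZ (γ t + Real.pi / 2) i k) t := by
  have h1 : HasDerivAt (fun s => Complex.I * (γ s : ℂ)) (Complex.I * (γ' : ℂ)) t :=
    h.ofReal_comp.const_mul _
  have e1 : Complex.exp (Complex.I * ((γ t + Real.pi / 2 : ℝ) : ℂ)) =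
      Complex.exp (Complex.I * γ t) * Complex.I := by
    rw [show Complex.I * ((γ t + Real.pi / 2 : ℝ) : ℂ) =
      Complex.I * γ t + Real.pi / 2 * Complex.I by push_cast; ring, Complex.exp_add,
      Complex.exp_pi_div_two_mul_I]
  have e2 : Complex.exp (-(Complex.I * ((γ t + Real.pi / 2 : ℝ) : ℂ))) =
      -(Complex.exp (-(Complex.I * γ t)) * Complex.I) := by
    rw [Complex.exp_neg, e1, Complex.exp_neg, mul_inv, Complex.inv_I]; ring
  simp only [rotZ_eq, e1, e2]
  fin_cases i <;> fin_cases k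
  · simpa [mul_comm, mul_left_comm, mul_assoc] using h1.cexp
  · simpa using hasDerivAt_const t (0 : ℂ)
  · simpa using hasDerivAt_const t (0 : ℂ)
  · simpa [mul_comm, mul_left_comm, mul_assoc] using h1.neg.cexp

/-- The product rule, with each differentiated factor absorbed as a phase shift. Stating it along a
curve covers segments as well as lines in the reduced phases. -/
theorem hasDerivAt_qspU (d : ℕ) (x : ℝ) {γ : ℝ → Fin (d + 1) → ℝ} {γ' : Fin (d + 1) → ℝ} {t : ℝ}
    (h : ∀ j, HasDerivAt (fun s => γ s j) (γ' j) t) (i k : Fin 2) :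
    HasDerivAt (fun s => qspU d x (γ s) i k)
      (∑ j, (γ' j : ℂ) * qspU d x (γ t + Pi.single j (Real.pi / 2)) i k) t := by
  induction d generalizing i with
  | zero => simpa [qspU_zero] using hasDerivAt_rotZ (h 0) i k
  | succ d ih =>
    have ih' := ih (γ := fun s j => γ s j.succ) (γ' := fun j => γ' j.succ) (fun j => h j.succ)
    simp only [qspU_succ, Matrix.mul_apply (M := _ * _)]
    have h1 : ∀ l, HasDerivAt (fun s => (rotZ (γ s 0) * signalW x) i l)
        ((γ' 0 : ℂ) * (rotZ (γ t 0 + Real.pi / 2) * signalW x) i l) t := by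
      intro l
      simp only [Matrix.mul_apply, Finset.mul_sum, ← mul_assoc]
      exact HasDerivAt.fun_sum fun m _ => (hasDerivAt_rotZ (h 0) i m).mul_const _
    refine (HasDerivAt.fun_sum (u := Finset.univ) fun l _ => (h1 l).mul (ih' l)).congr_deriv ?_
    symm
    have e0 : ∀ j : Fin (d + 1),
        (γ t + Pi.single (M := fun _ => ℝ) j.succ (Real.pi / 2)) 0 = γ t 0 := by
      intro j; simp [(Fin.succ_ne_zero j).symm]
    have e1 : (fun j : Fin (d + 1) =>
        (γ t + Pi.single (M := fun _ : Fin (d + 2) => ℝ) 0 (Real.pi / 2)) j.succ) =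
        fun j => γ t j.succ := by
      funext j; simp
    have e2 : ∀ j : Fin (d + 1), (fun l : Fin (d + 1) =>
        (γ t + Pi.single (M := fun _ => ℝ) j.succ (Real.pi / 2)) l.succ) =
        (fun l => γ t l.succ) + Pi.single j (Real.pi / 2) := by
      intro j; funext l; simp [Pi.single_apply, Fin.succ_inj]
    rw [Fin.sum_univ_succ, Finset.sum_add_distrib]
    simp only [e0, e1, e2]
    congr 1
    · simp [mul_assoc, mul_add]
    · simp only [Finset.mul_sum]
      rw [Finset.sum_comm]
      refine Finset.sum_congr rfl fun l _ => Finset.sum_congr rfl fun j _ => ?_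
      ring

theorem hasDerivAt_qspG (d : ℕ) (x : ℝ) {γ : ℝ → Fin (d + 1) → ℝ} {γ' : Fin (d + 1) → ℝ} {t : ℝ}
    (h : ∀ j, HasDerivAt (fun s => γ s j) (γ' j) t) :
    HasDerivAt (fun s => qspG d x (γ s))
      (∑ j, γ' j * qspG d x (γ t + Pi.single j (Real.pi / 2))) t := by
  have := Complex.reCLM.hasFDerivAt.comp_hasDerivAt t (hasDerivAt_qspU d x h 0 0)
  simpa [qspG, Function.comp_def] using this

/-- Mean value inequality on the segment: each partial derivative is itself a value of `g`, so at
most 1 in modulus. -/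
theorem abs_qspG_sub_le (d : ℕ) (x : ℝ) (hx : x ∈ Set.Icc (-1 : ℝ) 1) (Φ Ψ : Fin (d + 1) → ℝ) :
    |qspG d x Φ - qspG d x Ψ| ≤ ∑ j, |Φ j - Ψ j| := by
  have hγ : ∀ (t : ℝ) j, HasDerivAt (fun s : ℝ => (Ψ + s • (Φ - Ψ)) j) (Φ j - Ψ j) t := by
    intro t j
    simpa using ((hasDerivAt_id t).mul_const (Φ j - Ψ j)).const_add (Ψ j)
  have key := (convex_univ (𝕜 := ℝ)).norm_image_sub_le_of_norm_hasDerivWithin_le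
    (f := fun s : ℝ => qspG d x (Ψ + s • (Φ - Ψ))) (x := 0) (y := 1)
    (C := ∑ j, |Φ j - Ψ j|)
    (fun t _ => (hasDerivAt_qspG d x (hγ t)).hasDerivWithinAt) (fun t _ => by
      refine (norm_sum_le _ _).trans (Finset.sum_le_sum fun j _ => ?_)
      rw [norm_mul, Real.norm_eq_abs, Real.norm_eq_abs]
      exact mul_le_of_le_one_right (abs_nonneg _) (abs_qspG_le_one d x hx _))
    (Set.mem_univ _) (Set.mem_univ _)
  simpa using key

/-! ### The Hessian of the cost function -/

/-- The derivative of `g(x, ·)` at `unfold φ` in the direction `unfold v`. -/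
noncomputable def dirG (d : ℕ) (x : ℝ) (φ v : Fin (dTilde d) → ℝ) : ℝ :=
  ∑ j, unfold v j * qspG d x (unfold φ + Pi.single j (Real.pi / 2))

theorem hasDerivAt_unfold_line {d : ℕ} (φ v : Fin (dTilde d) → ℝ) (t : ℝ) (j : Fin (d + 1)) :
    HasDerivAt (fun s : ℝ => unfold (φ + s • v) j) (unfold v j) t := by
  have h := ((hasDerivAt_id t).mul_const (unfold v j)).const_add (unfold φ j)
  rw [one_mul] at h
  exact h

theorem hasDerivAt_qspG_line (d : ℕ) (x : ℝ) (φ v : Fin (dTilde d) → ℝ) :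
    HasDerivAt (fun s : ℝ => qspG d x (unfold (φ + s • v))) (dirG d x φ v) 0 := by
  refine (hasDerivAt_qspG d x (hasDerivAt_unfold_line φ v 0)).congr_deriv ?_
  rw [zero_smul, add_zero, dirG]

/-- Differentiability is enough: in the Hessian this second derivative is multiplied by a vanishing
residual. -/
theorem differentiableAt_dirG_line (d : ℕ) (x : ℝ) (φ v w : Fin (dTilde d) → ℝ) :
    DifferentiableAt ℝ (fun s : ℝ => dirG d x (φ + s • w) v) 0 := by
  have hγ : ∀ j l, HasDerivAt (fun s : ℝ => (unfold (φ + s • w) +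
      Pi.single (M := fun _ : Fin (d + 1) => ℝ) j (Real.pi / 2)) l) (unfold w l) 0 := by
    intro j l
    simp only [Pi.add_apply (f := unfold _)]
    exact (hasDerivAt_unfold_line φ w 0 l).add_const _
  have h : ∀ j, DifferentiableAt ℝ
      (fun s : ℝ => qspG d x (unfold (φ + s • w) + Pi.single j (Real.pi / 2))) 0 := fun j =>
    (hasDerivAt_qspG d x (hγ j)).differentiableAt
  exact DifferentiableAt.fun_sum (u := Finset.univ) fun j _ => (h j).const_mul (unfold v j)

theorem lineDeriv_cost (d : ℕ) (f : ℝ[X]) (φ v : Fin (dTilde d) → ℝ) :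
    lineDeriv ℝ (cost d f) φ v = 2 / (dTilde d : ℝ) * ∑ k ∈ Finset.Icc 1 (dTilde d),
      (qspG d (node d k) (unfold φ) - f.eval (node d k)) * dirG d (node d k) φ v := by
  refine HasDerivAt.deriv ?_
  have h := HasDerivAt.const_mul (1 / (dTilde d : ℝ)) <|
    HasDerivAt.fun_sum (u := Finset.Icc 1 (dTilde d)) fun (k : ℕ) _ =>
    ((hasDerivAt_qspG_line d (node d k) φ v).sub_const (f.eval (node d k))).pow 2
  simp only [cost, sq_abs]
  refine h.congr_deriv ?_
  simp only [Finset.mul_sum]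
  refine Finset.sum_congr rfl fun k _ => ?_
  simp
  ring

/-- Interpolation at the nodes kills the second-derivative term, leaving products of first
derivatives. -/
theorem hessian_cost_apply (d : ℕ) (f : ℝ[X]) (φ : Fin (dTilde d) → ℝ)
    (h : ∀ k ∈ Finset.Icc 1 (dTilde d), qspG d (node d k) (unfold φ) = f.eval (node d k))
    (i j : Fin (dTilde d)) :
    hessian (cost d f) φ i j = 2 / (dTilde d : ℝ) * ∑ k ∈ Finset.Icc 1 (dTilde d),
      dirG d (node d k) φ (Pi.single i 1) * dirG d (node d k) φ (Pi.single j 1) := by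
  simp only [hessian, Matrix.of_apply, lineDeriv_cost]
  refine HasDerivAt.deriv ?_
  have h1 := HasDerivAt.const_mul (2 / (dTilde d : ℝ)) <|
    HasDerivAt.fun_sum (u := Finset.Icc 1 (dTilde d)) fun (k : ℕ) _ =>
    ((hasDerivAt_qspG_line d (node d k) φ (Pi.single j 1)).sub_const (f.eval (node d k))).mul
      (differentiableAt_dirG_line d (node d k) φ (Pi.single i 1) (Pi.single j 1)).hasDerivAt
  refine h1.congr_deriv ?_
  congr 1
  refine Finset.sum_congr rfl fun k hk => ?_
  simp [h k hk, mul_comm]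

theorem dirG_eq_sum (d : ℕ) (x : ℝ) (φ v : Fin (dTilde d) → ℝ) :
    dirG d x φ v = ∑ i, v i * dirG d x φ (Pi.single i 1) := by
  simp only [dirG, Finset.mul_sum]
  rw [Finset.sum_comm]
  refine Finset.sum_congr rfl fun j _ => ?_
  simp [unfold, Pi.single_apply]

theorem dotProduct_hessian_cost (d : ℕ) (f : ℝ[X]) (φ v : Fin (dTilde d) → ℝ)
    (h : ∀ k ∈ Finset.Icc 1 (dTilde d), qspG d (node d k) (unfold φ) = f.eval (node d k)) :
    v ⬝ᵥ (hessian (cost d f) φ).mulVec v = 2 / (dTilde d : ℝ) *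
      ∑ k ∈ Finset.Icc 1 (dTilde d), dirG d (node d k) φ v ^ 2 := by
  have e : ∀ k, dirG d (node d k) φ v ^ 2 = ∑ i, ∑ j, v i * v j *
      (dirG d (node d k) φ (Pi.single i 1) * dirG d (node d k) φ (Pi.single j 1)) := by
    intro k
    rw [dirG_eq_sum d _ φ v, sq, Finset.sum_mul_sum]
    exact Finset.sum_congr rfl fun i _ => Finset.sum_congr rfl fun j _ => by ring
  simp only [e, dotProduct, Matrix.mulVec, hessian_cost_apply d f φ h]
  rw [Finset.sum_comm, Finset.mul_sum]
  refine Finset.sum_congr rfl fun i _ => ?_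
  rw [Finset.sum_comm, Finset.mul_sum, Finset.mul_sum]
  refine Finset.sum_congr rfl fun j _ => ?_
  rw [← Finset.mul_sum]
  ring

/-! ### The phase factors of the zero polynomial -/

/-- `e^{i t X}` -/
noncomputable def rotX (t : ℝ) : Matrix (Fin 2) (Fin 2) ℂ :=
  !![Complex.cos t, Complex.I * Complex.sin t; Complex.I * Complex.sin t, Complex.cos t]

theorem rotX_add (s t : ℝ) : rotX (s + t) = rotX s * rotX t := by
  ext i j
  fin_cases i <;> fin_cases j <;>
    simp [rotX, Matrix.mul_apply, Fin.sum_univ_two, Complex.cos_add, Complex.sin_add] <;>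
    ring_nf <;> simp [Complex.I_sq] <;> ring

theorem rotX_mul_pauliZ (t : ℝ) : rotX t * pauliZ = pauliZ * rotX (-t) := by
  ext i j
  fin_cases i <;> fin_cases j <;>
    simp [rotX, pauliZ, Matrix.mul_apply, Fin.sum_univ_two]

theorem signalW_cos {θ : ℝ} (h0 : 0 ≤ θ) (hπ : θ ≤ Real.pi) :
    signalW (Real.cos θ) = rotX θ := by
  rw [signalW_eq _ ⟨Real.neg_one_le_cos θ, Real.cos_le_one θ⟩, ← Real.sin_sq,
    Real.sqrt_sq (Real.sin_nonneg_of_nonneg_of_le_pi h0 hπ), rotX]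
  push_cast
  rfl

theorem rotZ_add (s t : ℝ) : rotZ (s + t) = rotZ s * rotZ t := by
  ext i j
  fin_cases i <;> fin_cases j <;>
    simp [rotZ_eq, Matrix.mul_apply, Fin.sum_univ_two, ← Complex.exp_add] <;> ring_nf

theorem rotZ_zero : rotZ 0 = 1 := by
  ext i j
  fin_cases i <;> fin_cases j <;> simp [rotZ_eq]

theorem rotZ_pi_div_two : rotZ (Real.pi / 2) = Complex.I • pauliZ := by
  have h : Complex.exp (Complex.I * (Real.pi / 2)) = Complex.I := by
    rw [mul_comm, Complex.exp_pi_div_two_mul_I]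
  ext i j
  fin_cases i <;> fin_cases j <;>
    simp [rotZ_eq, pauliZ, h, Complex.exp_neg]

theorem qspU_add_single_zero (d : ℕ) (x : ℝ) (Φ : Fin (d + 1) → ℝ) (c : ℝ) :
    qspU d x (Φ + Pi.single 0 c) = rotZ c * qspU d x Φ := by
  simp [qspU, add_comm _ c, rotZ_add, mul_assoc]

theorem qspU_single_last (d : ℕ) {θ : ℝ} (h0 : 0 ≤ θ) (hπ : θ ≤ Real.pi) (c : ℝ) :
    qspU d (Real.cos θ) (Pi.single (Fin.last d) c) = rotX (d * θ) * rotZ c := by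
  induction d with
  | zero =>
    rw [qspU_zero]
    ext i j
    fin_cases i <;> fin_cases j <;> simp [rotX, Matrix.mul_apply, Fin.sum_univ_two]
  | succ d ih =>
    have e : (fun j : Fin (d + 1) => (Pi.single (Fin.last (d + 1)) c : Fin (d + 2) → ℝ) j.succ) =
        Pi.single (Fin.last d) c := by
      funext j
      simp only [Pi.single_apply, ← Fin.succ_last, Fin.succ_inj]
    rw [qspU_succ, e, ih, signalW_cos h0 hπ, ← Fin.succ_last, Pi.single_eq_of_ne (by simp),
      rotZ_zero, one_mul, ← mul_assoc, ← rotX_add]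
    congr 2
    push_cast
    ring

/-- The shift inserts `iZ` after `j` signal factors. Moving `Z` to the far left reverses their
angles, so the total angle is `-jθ + (d - j)θ`. -/
theorem qspU_single_last_add_single (d : ℕ) {θ : ℝ} (h0 : 0 ≤ θ) (hπ : θ ≤ Real.pi) (c : ℝ)
    (j : Fin (d + 1)) :
    qspU d (Real.cos θ) (Pi.single (Fin.last d) c + Pi.single j (Real.pi / 2)) =
      Complex.I • (pauliZ * rotX ((d - 2 * j) * θ) * rotZ c) := by
  induction d with
  | zero =>
    have hj : j = 0 := Fin.fin_one_eq_zero j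
    subst hj
    rw [qspU_add_single_zero, qspU_single_last 0 h0 hπ, rotZ_pi_div_two]
    simp [mul_assoc]
  | succ d ih =>
    refine Fin.cases ?_ (fun l => ?_) j
    · rw [qspU_add_single_zero, qspU_single_last _ h0 hπ, rotZ_pi_div_two]
      simp [mul_assoc]
    · have e : (fun k : Fin (d + 1) => (Pi.single (Fin.last (d + 1)) c +
          Pi.single l.succ (Real.pi / 2) : Fin (d + 2) → ℝ) k.succ) =
          Pi.single (Fin.last d) c + Pi.single l (Real.pi / 2) := by
        funext k
        simp only [Pi.add_apply, Pi.single_apply, ← Fin.succ_last, Fin.succ_inj]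
      have e0 : (Pi.single (Fin.last (d + 1)) c + Pi.single l.succ (Real.pi / 2) :
          Fin (d + 2) → ℝ) 0 = 0 := by
        rw [Pi.add_apply, ← Fin.succ_last, Pi.single_eq_of_ne (by simp),
          Pi.single_eq_of_ne (Fin.succ_ne_zero l).symm, add_zero]
      rw [qspU_succ, e, ih, e0, signalW_cos h0 hπ, rotZ_zero, one_mul, Matrix.mul_smul,
        ← mul_assoc, ← mul_assoc, rotX_mul_pauliZ, mul_assoc pauliZ, ← rotX_add]
      congr 4
      simp only [Fin.val_succ]
      push_cast
      ring

/-- The maximal phase factors `(π/4, 0, …, 0, π/4)` of the zero polynomial. -/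
noncomputable def basePhase (d : ℕ) : Fin (d + 1) → ℝ :=
  Pi.single (Fin.last d) (Real.pi / 4) + Pi.single 0 (Real.pi / 4)

/-- The two end phases contribute `e^{iπ/4} e^{iπ/4} = i`, and the inserted `iZ` a second `i`; hence
the sign. -/
theorem qspG_basePhase_add_single (d : ℕ) {θ : ℝ} (h0 : 0 ≤ θ) (hπ : θ ≤ Real.pi)
    (j : Fin (d + 1)) :
    qspG d (Real.cos θ) (basePhase d + Pi.single j (Real.pi / 2)) =
      -Real.cos ((d - 2 * j) * θ) := by
  have h : Complex.exp (Complex.I * ((Real.pi / 4 : ℝ) : ℂ)) *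
      Complex.exp (Complex.I * ((Real.pi / 4 : ℝ) : ℂ)) = Complex.I := by
    rw [← Complex.exp_add, show Complex.I * ((Real.pi / 4 : ℝ) : ℂ) +
      Complex.I * ((Real.pi / 4 : ℝ) : ℂ) = Real.pi / 2 * Complex.I by push_cast; ring,
      Complex.exp_pi_div_two_mul_I]
  have key : qspU d (Real.cos θ) (basePhase d + Pi.single j (Real.pi / 2)) 0 0 =
      ((-Real.cos ((d - 2 * j) * θ) : ℝ) : ℂ) := by
    rw [basePhase, add_right_comm, qspU_add_single_zero,
      qspU_single_last_add_single d h0 hπ, rotZ_eq]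
    simp only [Matrix.mul_apply, Fin.sum_univ_two, Matrix.smul_apply, pauliZ, rotX]
    simp
    push_cast at h
    linear_combination Complex.I * Complex.cos ((d - 2 * j) * θ) * h +
      Complex.cos ((d - 2 * j) * θ) * Complex.I_mul_I
  rw [qspG, key, Complex.ofReal_re]

/-! ### Discrete orthogonality at the nodes -/

/-- The angles are odd multiples of `a = uπ/(2N)`, so multiplying by `2 sin a` telescopes the sum to
`sin(uπ) = 0`. The bound on `u` ensures `sin a ≠ 0` when `u ≠ 0`. -/
theorem sum_cos_nodes {N : ℕ} (hN : 0 < N) (u : ℤ) (hu : |u| < 2 * N) :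
    ∑ k ∈ Finset.Icc 1 N, Real.cos (2 * u * ((2 * (k : ℝ) - 1) / (4 * N) * Real.pi)) =
      if u = 0 then (N : ℝ) else 0 := by
  split_ifs with h
  · simp [h]
  have hN' : (0 : ℝ) < N := by exact_mod_cast hN
  set a : ℝ := u * Real.pi / (2 * N) with ha
  have hu' : |(u : ℝ)| < 2 * N := by exact_mod_cast hu
  have hs : Real.sin a ≠ 0 := by
    have h1 := abs_lt.mp hu'
    have hne : a ≠ 0 := by
      have : (u : ℝ) ≠ 0 := by exact_mod_cast h
      have := Real.pi_ne_zero
      positivity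
    rw [Ne, Real.sin_eq_zero_iff_of_lt_of_lt]
    · exact hne
    · rw [ha, lt_div_iff₀ (by positivity)]
      nlinarith [Real.pi_pos, h1.1]
    · rw [ha, div_lt_iff₀ (by positivity)]
      nlinarith [Real.pi_pos, h1.2]
  have tele : ∀ n : ℕ, 2 * Real.sin a *
      ∑ k ∈ Finset.Icc 1 n, Real.cos (2 * u * ((2 * (k : ℝ) - 1) / (4 * N) * Real.pi)) =
      Real.sin (2 * n * a) := by
    intro n
    induction n with
    | zero => simp
    | succ n ih =>
      rw [Finset.sum_Icc_succ_top (by omega), mul_add, ih]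
      have e1 : 2 * (u : ℝ) * ((2 * ((n + 1 : ℕ) : ℝ) - 1) / (4 * N) * Real.pi) =
          2 * n * a + a := by
        rw [ha]; push_cast; field_simp; ring
      have e2 : 2 * ((n + 1 : ℕ) : ℝ) * a = (2 * n * a + a) + a := by push_cast; ring
      have e3 : Real.sin (2 * n * a) = Real.sin ((2 * n * a + a) - a) := by ring_nf
      rw [e1, e2, e3, Real.sin_add, Real.sin_sub]
      ring
  have hz := tele N
  have e : 2 * (N : ℝ) * a = u * Real.pi := by rw [ha]; field_simp
  rw [e, Real.sin_int_mul_pi] at hz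
  exact (mul_eq_zero.mp hz).resolve_left (mul_ne_zero two_ne_zero hs)

/-- After product-to-sum, only `l = j` and `l = d - j` survive the node sum. By symmetry of `V` each
contributes `N V_j² / 2`. -/
theorem sum_sq_cos_nodes {d N : ℕ} (hd : d < 2 * N) {V : Fin (d + 1) → ℝ} (hV : IsSymmetric V) :
    ∑ k ∈ Finset.Icc 1 N, (∑ j : Fin (d + 1), V j *
      Real.cos ((d - 2 * j) * ((2 * (k : ℝ) - 1) / (4 * N) * Real.pi))) ^ 2 =
      N * ∑ j, V j ^ 2 := by
  have hN : 0 < N := by omega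
  have expand : ∀ θ : ℝ, (∑ j : Fin (d + 1), V j * Real.cos ((d - 2 * j) * θ)) ^ 2 =
      ∑ j : Fin (d + 1), ∑ l : Fin (d + 1), V j * V l / 2 *
        (Real.cos (2 * ((d - j - l : ℤ) : ℝ) * θ) + Real.cos (2 * ((l - j : ℤ) : ℝ) * θ)) := by
    intro θ
    rw [sq, Finset.sum_mul_sum]
    refine Finset.sum_congr rfl fun j _ => Finset.sum_congr rfl fun l _ => ?_
    have e1 : 2 * ((d - j - l : ℤ) : ℝ) * θ = (d - 2 * j) * θ + (d - 2 * l) * θ := by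
      push_cast; ring
    have e2 : 2 * ((l - j : ℤ) : ℝ) * θ = (d - 2 * j) * θ - (d - 2 * l) * θ := by
      push_cast; ring
    rw [e1, e2, Real.cos_add, Real.cos_sub]
    ring
  have h1 : ∀ j l : Fin (d + 1), ((d : ℤ) - j - l = 0) ↔ l = j.rev := by
    intro j l
    rw [Fin.ext_iff, Fin.val_rev]
    omega
  have h2 : ∀ j l : Fin (d + 1), ((l : ℤ) - j = 0) ↔ l = j := by
    intro j l
    rw [Fin.ext_iff]
    omega
  simp only [expand]
  rw [Finset.sum_comm, Finset.mul_sum]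
  refine Finset.sum_congr rfl fun j _ => ?_
  rw [Finset.sum_comm]
  have h3 : ∀ l : Fin (d + 1), ∑ k ∈ Finset.Icc 1 N, V j * V l / 2 *
      (Real.cos (2 * ((d - j - l : ℤ) : ℝ) * ((2 * (k : ℝ) - 1) / (4 * N) * Real.pi)) +
        Real.cos (2 * ((l - j : ℤ) : ℝ) * ((2 * (k : ℝ) - 1) / (4 * N) * Real.pi))) =
      (if l = j.rev then V j * V l / 2 * N else 0) + (if l = j then V j * V l / 2 * N else 0) := by
    intro l
    have := j.2
    have := l.2
    rw [← Finset.mul_sum, Finset.sum_add_distrib, sum_cos_nodes hN _ (by rw [abs_lt]; omega),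
      sum_cos_nodes hN _ (by rw [abs_lt]; omega)]
    simp only [h1, h2, mul_add, mul_ite, mul_zero]
  simp only [h3, Finset.sum_add_distrib, Finset.sum_ite_eq', Finset.mem_univ, if_true, hV j]
  ring

/-! ### The quadratic form near the base phases -/

theorem node_eq (d k : ℕ) :
    node d k = Real.cos ((2 * (k : ℝ) - 1) / (4 * (dTilde d : ℝ)) * Real.pi) := rfl

theorem node_mem_Icc (d k : ℕ) : node d k ∈ Set.Icc (-1 : ℝ) 1 :=
  ⟨Real.neg_one_le_cos _, Real.cos_le_one _⟩

theorem abs_gradient_sub_le (d : ℕ) {x : ℝ} (hx : x ∈ Set.Icc (-1 : ℝ) 1)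
    (Φ Ψ V : Fin (d + 1) → ℝ) :
    |∑ j, V j * qspG d x (Φ + Pi.single j (Real.pi / 2)) -
      ∑ j, V j * qspG d x (Ψ + Pi.single j (Real.pi / 2))| ≤
      (∑ j, |V j|) * ∑ j, |Φ j - Ψ j| := by
  rw [← Finset.sum_sub_distrib, Finset.sum_mul]
  refine (Finset.abs_sum_le_sum_abs _ _).trans (Finset.sum_le_sum fun j _ => ?_)
  rw [← mul_sub, abs_mul]
  refine mul_le_mul_of_nonneg_left ?_ (abs_nonneg _)
  have h := abs_qspG_sub_le d x hx (Φ + Pi.single j (Real.pi / 2)) (Ψ + Pi.single j (Real.pi / 2))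
  simp only [Pi.add_apply, add_sub_add_right_eq_sub] at h
  exact h

/-- Cauchy–Schwarz is used twice, from `ℓ¹` to `ℓ²`, for `V` and for `Φ - Ψ`; each use costs a
factor `d + 1`. -/
theorem sq_gradient_sub_le (d : ℕ) {x : ℝ} (hx : x ∈ Set.Icc (-1 : ℝ) 1)
    {Φ Ψ V : Fin (d + 1) → ℝ} (hΦ : ((d : ℝ) + 1) ^ 2 * ∑ j, (Φ j - Ψ j) ^ 2 ≤ 1 / 25) :
    (∑ j, V j * qspG d x (Φ + Pi.single j (Real.pi / 2)) -
      ∑ j, V j * qspG d x (Ψ + Pi.single j (Real.pi / 2))) ^ 2 ≤ (∑ j, V j ^ 2) / 25 := by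
  have hD : (∑ j, |Φ j - Ψ j|) ^ 2 ≤ (d + 1) * ∑ j, (Φ j - Ψ j) ^ 2 := by
    simpa using sq_sum_le_card_mul_sum_sq (s := Finset.univ) (f := fun j => |Φ j - Ψ j|)
  have hV : (∑ j, |V j|) ^ 2 ≤ (d + 1) * ∑ j, V j ^ 2 := by
    simpa using sq_sum_le_card_mul_sum_sq (s := Finset.univ) (f := fun j => |V j|)
  have hS : 0 ≤ ∑ j, V j ^ 2 := Finset.sum_nonneg fun j _ => sq_nonneg _
  rw [← sq_abs]
  calc _ ≤ ((∑ j, |V j|) * ∑ j, |Φ j - Ψ j|) ^ 2 :=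
        pow_le_pow_left₀ (abs_nonneg _) (abs_gradient_sub_le d hx Φ Ψ V) 2
    _ = (∑ j, |V j|) ^ 2 * (∑ j, |Φ j - Ψ j|) ^ 2 := mul_pow _ _ _
    _ ≤ ((d + 1) * ∑ j, V j ^ 2) * ((d + 1) * ∑ j, (Φ j - Ψ j) ^ 2) := by gcongr
    _ = (∑ j, V j ^ 2) * (((d : ℝ) + 1) ^ 2 * ∑ j, (Φ j - Ψ j) ^ 2) := by ring
    _ ≤ (∑ j, V j ^ 2) * (1 / 25) := by gcongr
    _ = (∑ j, V j ^ 2) / 25 := by ring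

/-- The constant is `4/5 - 4/25`, from the exact value `N S` at the base phases and an error of at
most `S/25` per node. -/
theorem sum_sq_gradient_ge (d : ℕ) {Φ V : Fin (d + 1) → ℝ} (hV : IsSymmetric V)
    (hΦ : ((d : ℝ) + 1) ^ 2 * ∑ j, (Φ j - basePhase d j) ^ 2 ≤ 1 / 25) :
    16 / 25 * dTilde d * ∑ j, V j ^ 2 ≤ ∑ k ∈ Finset.Icc 1 (dTilde d),
      (∑ j, V j * qspG d (node d k) (Φ + Pi.single j (Real.pi / 2))) ^ 2 := by
  set N := dTilde d with hN
  have hdN : d < 2 * N := by rw [hN, dTilde]; omega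
  have hN0 : (0 : ℝ) < N := by exact_mod_cast (by omega : 0 < N)
  set S := ∑ j, V j ^ 2 with hS
  have hS0 : 0 ≤ S := Finset.sum_nonneg fun j _ => sq_nonneg _
  have hbase : ∑ k ∈ Finset.Icc 1 N,
      (∑ j, V j * qspG d (node d k) (basePhase d + Pi.single j (Real.pi / 2))) ^ 2 = N * S := by
    rw [← sum_sq_cos_nodes hdN hV]
    refine Finset.sum_congr rfl fun k hk => ?_
    have hk1 : (1 : ℝ) ≤ k := by exact_mod_cast (Finset.mem_Icc.mp hk).1
    have hkN : (k : ℝ) ≤ N := by exact_mod_cast (Finset.mem_Icc.mp hk).2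
    have h0 : 0 ≤ (2 * (k : ℝ) - 1) / (4 * N) * Real.pi :=
      mul_nonneg (div_nonneg (by linarith) (by linarith)) Real.pi_pos.le
    have hπ : (2 * (k : ℝ) - 1) / (4 * N) * Real.pi ≤ Real.pi :=
      mul_le_of_le_one_left Real.pi_pos.le ((div_le_one (by linarith)).mpr (by linarith))
    simp only [node_eq, ← hN, qspG_basePhase_add_single d h0 hπ, mul_neg, Finset.sum_neg_distrib,
      neg_sq]
  calc 16 / 25 * N * S = 4 / 5 * (N * S) - ∑ k ∈ Finset.Icc 1 N, 4 * (S / 25) := by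
        simp; ring
    _ ≤ _ := by
        rw [← hbase, Finset.mul_sum, ← Finset.sum_sub_distrib]
        refine Finset.sum_le_sum fun k _ => ?_
        have := sq_gradient_sub_le d (node_mem_Icc d k) (V := V) hΦ
        rw [← hS] at this
        set a := ∑ j, V j * qspG d (node d k) (Φ + Pi.single j (Real.pi / 2))
        set b := ∑ j, V j * qspG d (node d k) (basePhase d + Pi.single j (Real.pi / 2))
        -- This square gives `a² ≥ (4/5) b² - 4 (a - b)²`.
        nlinarith [sq_nonneg (5 * (a - b) + b)]

theorem unfold_isSymmetric {d : ℕ} (v : Fin (dTilde d) → ℝ) : IsSymmetric (unfold v) := by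
  intro j
  have := j.2
  simp only [unfold, Fin.val_rev]
  congr 2
  omega

theorem sum_sq_le_sum_sq_unfold {d : ℕ} (v : Fin (dTilde d) → ℝ) :
    ∑ i, v i ^ 2 ≤ ∑ j, unfold v j ^ 2 := by
  have h : dTilde d ≤ d + 1 := by unfold dTilde; omega
  calc ∑ i, v i ^ 2 = ∑ j ∈ Finset.univ.map (Fin.castLEEmb h), unfold v j ^ 2 := by
        rw [Finset.sum_map]
        refine Finset.sum_congr rfl fun i _ => ?_
        have hi := i.2
        simp only [unfold]
        congr 2
        ext
        simp only [Fin.castLEEmb_apply, Fin.val_castLE]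
        unfold dTilde at hi
        omega
    _ ≤ _ := Finset.sum_le_sum_of_subset_of_nonneg (Finset.subset_univ _)
        fun j _ _ => sq_nonneg _

/-- A quadratic form bounded below by `c > 0` is positive definite with least eigenvalue at
least `c`. -/
theorem exists_posDef_le_lambdaMin {n : ℕ} (hn : 0 < n) {A : Matrix (Fin n) (Fin n) ℝ}
    (hA : A.IsHermitian) {c : ℝ} (hc : 0 < c)
    (h : ∀ v : Fin n → ℝ, c * ∑ i, v i ^ 2 ≤ v ⬝ᵥ A.mulVec v) :
    ∃ hpos : A.PosDef, c ≤ lambdaMin hpos.isHermitian := by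
  have hpos : A.PosDef := by
    refine Matrix.PosDef.of_dotProduct_mulVec_pos hA fun v hv => ?_
    have h0 : 0 < ∑ i, v i ^ 2 := by
      obtain ⟨i, hi⟩ := Function.ne_iff.mp hv
      exact Finset.sum_pos' (fun j _ => sq_nonneg _) ⟨i, Finset.mem_univ _, sq_pos_of_ne_zero hi⟩
    simpa using (mul_pos hc h0).trans_le (h v)
  refine ⟨hpos, ?_⟩
  have : Nonempty (Fin n) := ⟨⟨0, hn⟩⟩
  refine le_ciInf fun i => ?_
  have hb := h (hpos.isHermitian.eigenvectorBasis i)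
  have hnorm : ∑ j, hpos.isHermitian.eigenvectorBasis i j ^ 2 = 1 := by
    have := hpos.isHermitian.eigenvectorBasis.orthonormal.1 i
    rw [EuclideanSpace.norm_eq, Real.sqrt_eq_one] at this
    simpa using this
  rw [hpos.isHermitian.mulVec_eigenvectorBasis, dotProduct_smul, hnorm, mul_one] at hb
  have e : (hpos.isHermitian.eigenvectorBasis i : Fin n → ℝ) ⬝ᵥ
      (hpos.isHermitian.eigenvectorBasis i : Fin n → ℝ) = 1 := by
    rw [← hnorm]
    exact Finset.sum_congr rfl fun j _ => (sq _).symm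
  rw [e] at hb
  simpa using hb

theorem hessian_posDef_of_near_basePhase (d : ℕ) (f : ℝ[X]) {Φ : Fin (d + 1) → ℝ}
    (hsymm : IsSymmetric Φ) (hg : ∀ x ∈ Set.Icc (-1 : ℝ) 1, qspG d x Φ = f.eval x)
    (hΦ : ((d : ℝ) + 1) ^ 2 * ∑ j, (Φ j - basePhase d j) ^ 2 ≤ 1 / 25) :
    ∃ hpos : (hessian (cost d f) (reduced Φ)).PosDef,
      (32 / 25 : ℝ) ≤ lambdaMin hpos.isHermitian := by
  have hN : 0 < dTilde d := Nat.succ_pos _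
  have hN0 : (0 : ℝ) < dTilde d := by exact_mod_cast hN
  have hU := unfold_reduced hsymm
  have h : ∀ k ∈ Finset.Icc 1 (dTilde d),
      qspG d (node d k) (unfold (reduced Φ)) = f.eval (node d k) := by
    intro k _
    rw [hU]
    exact hg _ (node_mem_Icc d k)
  have hH : (hessian (cost d f) (reduced Φ)).IsHermitian := by
    ext i j
    simp only [Matrix.conjTranspose_apply, hessian_cost_apply d f _ h, star_trivial]
    simp only [mul_comm]
  refine exists_posDef_le_lambdaMin hN hH (by norm_num) fun v => ?_
  rw [dotProduct_hessian_cost d f _ v h]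
  have h1 := sum_sq_gradient_ge d (unfold_isSymmetric v) hΦ
  simp only [dirG, hU]
  rw [div_mul_eq_mul_div 2, le_div_iff₀ hN0]
  nlinarith [sum_sq_le_sum_sq_unfold v]

/-! ### The roots in the unit disc -/

theorem map_conj_laurentPoly (d : ℕ) (f : ℝ[X]) :
    (laurentPoly d f).map (starRingEnd ℂ) = laurentPoly d f := by
  simp [laurentPoly, joukowski, Polynomial.map_sum, map_ofNat (starRingEnd ℂ) 2]

/-- Since `f` is real, the roots come in conjugate pairs. This makes `e(z⁻¹)` the conjugate of
`e(z)` on the circle. -/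
theorem map_conj_innerRoots (d : ℕ) (f : ℝ[X]) :
    (innerRoots d f).map (starRingEnd ℂ) = innerRoots d f := by
  classical
  have h : (laurentPoly d f).roots.map (starRingEnd ℂ) = (laurentPoly d f).roots := by
    rw [← (IsAlgClosed.splits (laurentPoly d f)).roots_map, map_conj_laurentPoly]
  conv_rhs => rw [innerRoots, ← h, Multiset.filter_map]
  simp [innerRoots]

/-- `∏ (z - r)`, over the roots in the unit disc. -/
noncomputable def rootPoly (d : ℕ) (f : ℝ[X]) : ℂ[X] :=
  ((innerRoots d f).map fun r => X - C r).prod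

/-- `∏ (1 - r z)`, over the roots in the unit disc. -/
noncomputable def revRootPoly (d : ℕ) (f : ℝ[X]) : ℂ[X] :=
  ((innerRoots d f).map fun r => 1 - C r * X).prod

theorem eval_rootPoly (d : ℕ) (f : ℝ[X]) (z : ℂ) :
    (rootPoly d f).eval z = ((innerRoots d f).map fun r => z - r).prod := by
  simp [rootPoly, eval_multiset_prod, Multiset.map_map]

theorem eval_revRootPoly (d : ℕ) (f : ℝ[X]) (z : ℂ) :
    (revRootPoly d f).eval z = ((innerRoots d f).map fun r => 1 - r * z).prod := by
  simp [revRootPoly, eval_multiset_prod, Multiset.map_map]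

theorem eval_zero_revRootPoly (d : ℕ) (f : ℝ[X]) : (revRootPoly d f).eval 0 = 1 := by
  simp [eval_revRootPoly]

theorem eval_revRootPoly_eq (d : ℕ) (f : ℝ[X]) {z : ℂ} (hz : z ≠ 0) :
    (revRootPoly d f).eval z =
      z ^ Multiset.card (innerRoots d f) * (rootPoly d f).eval z⁻¹ := by
  rw [eval_revRootPoly, eval_rootPoly]
  induction innerRoots d f using Multiset.induction_on with
  | empty => simp
  | cons r D ih =>
    simp only [Multiset.map_cons, Multiset.prod_cons, Multiset.card_cons, ih, pow_succ]
    field_simp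

theorem conj_eval_rootPoly (d : ℕ) (f : ℝ[X]) (z : ℂ) :
    (starRingEnd ℂ) ((rootPoly d f).eval z) = (rootPoly d f).eval ((starRingEnd ℂ) z) := by
  rw [eval_rootPoly, eval_rootPoly, map_multiset_prod, Multiset.map_map]
  conv_rhs => rw [← map_conj_innerRoots, Multiset.map_map]
  simp

theorem norm_lt_one_of_mem_innerRoots {d : ℕ} {f : ℝ[X]} {r : ℂ} (h : r ∈ innerRoots d f) :
    ‖r‖ < 1 := by
  classical
  exact (Multiset.mem_filter.mp h).2

theorem eval_laurentPoly_of_mem_innerRoots {d : ℕ} {f : ℝ[X]} {r : ℂ} (h : r ∈ innerRoots d f) :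
    (laurentPoly d f).eval r = 0 := by
  classical
  exact (mem_roots'.mp (Multiset.mem_filter.mp h).1).2

/-- The constant term is minus the square of the leading coefficient of `f` over `2^d`. -/
theorem eval_zero_laurentPoly_ne_zero {d : ℕ} (hd : 1 ≤ d) {f : ℝ[X]} (hf : f.degree = d) :
    (laurentPoly d f).eval 0 ≠ 0 := by
  have hlead : f.coeff d ≠ 0 := by
    rw [← natDegree_eq_of_degree_eq_some hf]
    exact leadingCoeff_ne_zero.mpr fun h => by simp [h] at hf
  have hj : (joukowski d f).eval 0 = (f.coeff d : ℂ) / 2 ^ d := by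
    rw [joukowski, eval_finsetSum, Finset.sum_range_succ, Finset.sum_eq_zero]
    · simp
    · intro j hj
      have : d - j ≠ 0 := by have := Finset.mem_range.mp hj; omega
      simp [this]
  have h2 : 2 * d ≠ 0 := by omega
  rw [laurentPoly, eval_sub, eval_pow, eval_pow, hj]
  simp only [eval_X, zero_pow h2, zero_sub, neg_ne_zero]
  exact pow_ne_zero _ (div_ne_zero (by exact_mod_cast hlead) (by simp))

theorem eval_zero_rootPoly_ne_zero {d : ℕ} (hd : 1 ≤ d) {f : ℝ[X]} (hf : f.degree = d) :
    (rootPoly d f).eval 0 ≠ 0 := by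
  rw [eval_rootPoly, Ne, Multiset.prod_eq_zero_iff, Multiset.mem_map]
  rintro ⟨r, hr, h0⟩
  rw [zero_sub, neg_eq_zero] at h0
  exact eval_zero_laurentPoly_ne_zero hd hf (h0 ▸ eval_laurentPoly_of_mem_innerRoots hr)

theorem norm_eval_zero_rootPoly_lt_one {d : ℕ} {f : ℝ[X]} (h : innerRoots d f ≠ 0) :
    ‖(rootPoly d f).eval 0‖ < 1 := by
  rw [eval_rootPoly]
  have hlt : ∀ r ∈ innerRoots d f, ‖r‖ < 1 := fun r => norm_lt_one_of_mem_innerRoots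
  generalize innerRoots d f = D at h hlt ⊢
  induction D using Multiset.induction_on with
  | empty => exact absurd rfl h
  | cons r D ih =>
    have hr := hlt r (Multiset.mem_cons_self r D)
    simp only [Multiset.map_cons, Multiset.prod_cons, norm_mul, zero_sub, norm_neg]
    by_cases hD : D = 0
    · simpa [hD] using hr
    · have := ih hD (fun r hr => hlt r (Multiset.mem_cons_of_mem hr))
      simp only [zero_sub] at this
      exact mul_lt_one_of_nonneg_of_lt_one_left (norm_nonneg _) hr this.le

theorem eval_revRootPoly_ne_zero {d : ℕ} {f : ℝ[X]} {z : ℂ} (hz : ‖z‖ ≤ 1) :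
    (revRootPoly d f).eval z ≠ 0 := by
  rw [eval_revRootPoly, Ne, Multiset.prod_eq_zero_iff, Multiset.mem_map]
  rintro ⟨r, hr, h0⟩
  have h1 : ‖r * z‖ = 1 := by rw [← sub_eq_zero.mp h0, norm_one]
  have h2 := norm_lt_one_of_mem_innerRoots hr
  rw [norm_mul] at h1
  nlinarith [norm_nonneg r, norm_nonneg z]

/-- By the maximum principle for `1 / ∏ (1 - r z)`, which is `1` at `0`. -/
theorem one_le_of_le_norm_revRootPoly {d : ℕ} {f : ℝ[X]} {c : ℝ} (hc : 0 < c)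
    (h : ∀ z : ℂ, ‖z‖ = 1 → c ≤ ‖(revRootPoly d f).eval z‖) : c ≤ 1 := by
  have hne : ∀ z ∈ Metric.closedBall (0 : ℂ) 1, (revRootPoly d f).eval z ≠ 0 := fun z hz =>
    eval_revRootPoly_ne_zero (by simpa using hz)
  have hd : DiffContOnCl ℂ (fun z => ((revRootPoly d f).eval z)⁻¹) (Metric.ball 0 1) := by
    refine DifferentiableOn.diffContOnCl fun z hz => ?_
    rw [closure_ball (0 : ℂ) one_ne_zero] at hz
    exact ((revRootPoly d f).differentiable z).differentiableWithinAt.inv (hne z hz)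
  have hmax := Complex.norm_le_of_forall_mem_frontier_norm_le (C := c⁻¹) (z := 0)
    Metric.isBounded_ball hd (fun z hz => by
      rw [frontier_ball (0 : ℂ) one_ne_zero] at hz
      rw [norm_inv]
      exact inv_anti₀ hc (h z (by simpa using hz)))
    (subset_closure (Metric.mem_ball_self one_pos))
  rw [eval_zero_revRootPoly] at hmax
  simpa using (one_le_inv₀ hc).mp (by simpa using hmax)

/-! ### Points of the unit circle -/

theorem normSq_circlePt {x : ℝ} (hx : x ∈ Set.Icc (-1 : ℝ) 1) :
    Complex.normSq (circlePt x) = 1 := by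
  have h0 : 0 ≤ 1 - x ^ 2 := by nlinarith [hx.1, hx.2]
  rw [Complex.normSq_apply]
  simp [circlePt, Real.mul_self_sqrt h0]
  ring

theorem circlePt_ne_zero {x : ℝ} (hx : x ∈ Set.Icc (-1 : ℝ) 1) : circlePt x ≠ 0 := by
  intro h
  simpa [h] using normSq_circlePt hx

theorem inv_circlePt {x : ℝ} (hx : x ∈ Set.Icc (-1 : ℝ) 1) :
    (circlePt x)⁻¹ = (starRingEnd ℂ) (circlePt x) := by
  rw [Complex.inv_def, normSq_circlePt hx]
  simp

theorem circlePt_re (x : ℝ) : (circlePt x).re = x := by simp [circlePt]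

theorem circlePt_im (x : ℝ) : (circlePt x).im = √(1 - x ^ 2) := by simp [circlePt]

/-- Transfers identities from the upper half circle to polynomials, which can then be evaluated at
`0`. -/
theorem eq_of_eval_circlePt_eq {p q : ℂ[X]}
    (h : ∀ x ∈ Set.Icc (-1 : ℝ) 1, p.eval (circlePt x) = q.eval (circlePt x)) : p = q := by
  refine eq_of_infinite_eval_eq p q (Set.Infinite.mono (s := circlePt '' Set.Icc (-1) 1) ?_ ?_)
  · rintro _ ⟨x, hx, rfl⟩
    exact h x hx
  · refine Set.Infinite.image (fun x _ y _ hxy => ?_) (Set.Icc_infinite (by norm_num))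
    rw [← circlePt_re x, hxy, circlePt_re]

theorem conj_eFun (d : ℕ) (f : ℝ[X]) {x : ℝ} (hx : x ∈ Set.Icc (-1 : ℝ) 1) :
    eFun d f (circlePt x)⁻¹ = (starRingEnd ℂ) (eFun d f (circlePt x)) := by
  simp only [eFun, ← eval_rootPoly, map_mul, map_inv₀, map_pow, conj_eval_rootPoly,
    inv_circlePt hx]

theorem eval_laurentPoly_circle {d : ℕ} {f : ℝ[X]} (hf : f.natDegree ≤ d) {z : ℂ}
    (hz : ‖z‖ = 1) :
    (laurentPoly d f).eval z = z ^ (2 * d) * ((1 - f.eval z.re ^ 2 : ℝ) : ℂ) := by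
  have hz0 : z ≠ 0 := fun h => by simp [h] at hz
  have hc : (z + z⁻¹) / 2 = algebraMap ℝ ℂ z.re := by
    rw [Complex.inv_def, Complex.normSq_eq_norm_sq, hz]
    simp [Complex.add_conj]
  rw [eval_laurentPoly d f hf z hz0, hc, eval_map_apply]
  simp

/-! ### The unitary as a matrix of polynomials in `z` -/

/-- `√2` times the Hadamard matrix. -/
def hadamard : Matrix (Fin 2) (Fin 2) ℂ := !![1, 1; 1, -1]

/-- Conjugation by the Hadamard matrix. -/
noncomputable def hadamardConj (M : Matrix (Fin 2) (Fin 2) ℂ) : Matrix (Fin 2) (Fin 2) ℂ :=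
  (2⁻¹ : ℂ) • (hadamard * M * hadamard)

theorem hadamard_mul_self : hadamard * hadamard = (2 : ℂ) • 1 := by
  ext i j
  fin_cases i <;> fin_cases j <;>
    simp [hadamard, Matrix.mul_apply, Fin.sum_univ_two] <;> norm_num

theorem hadamardConj_mul (M N : Matrix (Fin 2) (Fin 2) ℂ) :
    hadamardConj (M * N) = hadamardConj M * hadamardConj N := by
  have h : hadamard * M * hadamard * (hadamard * N * hadamard) =
      (2 : ℂ) • (hadamard * (M * N) * hadamard) := by
    calc _ = hadamard * M * (hadamard * hadamard) * (N * hadamard) := by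
          simp only [mul_assoc]
      _ = _ := by rw [hadamard_mul_self]; simp [mul_assoc]
  rw [hadamardConj, hadamardConj, hadamardConj, Matrix.smul_mul, Matrix.mul_smul, h, smul_smul,
    smul_smul]
  norm_num

theorem hadamardConj_eq (M : Matrix (Fin 2) (Fin 2) ℂ) :
    hadamardConj M = (2⁻¹ : ℂ) • !![M 0 0 + M 0 1 + M 1 0 + M 1 1, M 0 0 - M 0 1 + M 1 0 - M 1 1;
      M 0 0 + M 0 1 - M 1 0 - M 1 1, M 0 0 - M 0 1 - M 1 0 + M 1 1] := by
  rw [hadamardConj, Matrix.eta_fin_two M, hadamard, Matrix.mul_fin_two, Matrix.mul_fin_two]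
  ext i j
  fin_cases i <;> fin_cases j <;> simp <;> ring

theorem hadamardConj_rotZ (φ : ℝ) : hadamardConj (rotZ φ) = rotX φ := by
  have h1 : Complex.exp (Complex.I * φ) = Complex.cos φ + Complex.sin φ * Complex.I := by
    rw [mul_comm, Complex.exp_mul_I]
  have h2 : Complex.exp (-(Complex.I * φ)) = Complex.cos φ - Complex.sin φ * Complex.I := by
    rw [mul_comm, ← neg_mul, Complex.exp_mul_I, Complex.cos_neg, Complex.sin_neg]
    ring
  rw [hadamardConj_eq, rotZ_eq, h1, h2, rotX]
  ext i j
  fin_cases i <;> fin_cases j <;> simp <;> ring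

/-- The Hadamard matrix diagonalizes `W` to `diag(z, z⁻¹)`; the factor `z` removes the negative
power. -/
theorem circlePt_smul_hadamardConj_signalW {x : ℝ} (hx : x ∈ Set.Icc (-1 : ℝ) 1) :
    circlePt x • hadamardConj (signalW x) = !![circlePt x ^ 2, 0; 0, 1] := by
  have h : circlePt x * (x - Complex.I * (√(1 - x ^ 2) : ℝ)) = 1 := by
    have := mul_inv_cancel₀ (circlePt_ne_zero hx)
    rw [inv_circlePt hx] at this
    simpa [circlePt, sub_eq_add_neg] using this
  rw [hadamardConj_eq, signalW_eq x hx]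
  ext i j
  fin_cases i <;> fin_cases j
  · simp only [circlePt]; simp; ring
  · simp
  · simp
  · simp only [Matrix.smul_apply, Matrix.of_apply, smul_eq_mul, ← h]; simp; left; ring

/-- The entries of `z^d` times the Hadamard conjugate of `U`, as polynomials in `z`. -/
noncomputable def polyU : (d : ℕ) → (Fin (d + 1) → ℝ) → Matrix (Fin 2) (Fin 2) ℂ[X]
  | 0, Φ => (rotX (Φ 0)).map C
  | d + 1, Φ => (rotX (Φ 0)).map C * !![X ^ 2, 0; 0, 1] * polyU d fun j => Φ j.succ

theorem map_eval_polyU_succ (d : ℕ) (Φ : Fin (d + 2) → ℝ) (z : ℂ) :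
    (polyU (d + 1) Φ).map (eval z) =
      rotX (Φ 0) * !![z ^ 2, 0; 0, 1] * (polyU d fun j => Φ j.succ).map (eval z) := by
  ext i j
  fin_cases i <;> fin_cases j <;>
    simp [polyU, Matrix.mul_apply, Fin.sum_univ_two]

theorem map_eval_circlePt_polyU (d : ℕ) (Φ : Fin (d + 1) → ℝ) {x : ℝ}
    (hx : x ∈ Set.Icc (-1 : ℝ) 1) :
    (polyU d Φ).map (eval (circlePt x)) = circlePt x ^ d • hadamardConj (qspU d x Φ) := by
  induction d with
  | zero =>
    rw [qspU_zero, hadamardConj_rotZ]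
    ext i j
    simp [polyU]
  | succ d ih =>
    rw [map_eval_polyU_succ, ih, qspU_succ, hadamardConj_mul, hadamardConj_mul, hadamardConj_rotZ,
      ← circlePt_smul_hadamardConj_signalW hx]
    simp only [Matrix.mul_smul, Matrix.smul_mul, smul_smul, pow_succ]

/-- At `z = 0` each signal factor is the projection `diag(0, 1)`, so the matrix product collapses to
a product of single entries. -/
theorem eval_zero_polyU_row_one (d : ℕ) (Φ : Fin (d + 1) → ℝ) :
    (polyU d Φ 1 0).eval 0 = (∏ j : Fin d, Complex.cos (Φ j.castSucc)) *
      (Complex.I * Complex.sin (Φ (Fin.last d))) ∧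
    (polyU d Φ 1 1).eval 0 = (∏ j : Fin d, Complex.cos (Φ j.castSucc)) *
      Complex.cos (Φ (Fin.last d)) := by
  induction d with
  | zero => simp [polyU, rotX]
  | succ d ih =>
    have h := map_eval_polyU_succ d Φ 0
    have ih' := ih fun j => Φ j.succ
    simp only [Fin.succ_castSucc, Fin.succ_last] at ih'
    have e : ∀ k, (polyU (d + 1) Φ 1 k).eval 0 =
        Complex.cos (Φ 0) * (polyU d (fun j => Φ j.succ) 1 k).eval 0 := by
      intro k
      have := congrFun (congrFun h 1) k
      simpa [Matrix.mul_apply, Fin.sum_univ_two, rotX] using this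
    rw [e, e, ih'.1, ih'.2, Fin.prod_univ_succ]
    simp only [Fin.castSucc_zero, mul_assoc, and_self]

theorem eval_zero_polyU_row_zero (d : ℕ) (Φ : Fin (d + 2) → ℝ) (k : Fin 2) :
    (polyU (d + 1) Φ 0 k).eval 0 =
      Complex.I * Complex.sin (Φ 0) * (polyU d (fun j => Φ j.succ) 1 k).eval 0 := by
  have := congrFun (congrFun (map_eval_polyU_succ d Φ 0) 0) k
  simpa [Matrix.mul_apply, Fin.sum_univ_two, rotX] using this

/-! ### Relations between the phase factors and the roots -/

namespace IsMaximalSolution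

variable {d : ℕ} {f : ℝ[X]} {Φ : Fin (d + 1) → ℝ}

theorem qspU_apply (h : IsMaximalSolution d f Φ) {x : ℝ} (hx : x ∈ Set.Icc (-1 : ℝ) 1) :
    qspU d x Φ = !![((f.eval x : ℝ) : ℂ) + Complex.I * √(alpha d f) * (eFun d f (circlePt x)).re,
        Complex.I * √(alpha d f) * (eFun d f (circlePt x)).im;
      Complex.I * √(alpha d f) * (eFun d f (circlePt x)).im,
      ((f.eval x : ℝ) : ℂ) - Complex.I * √(alpha d f) * (eFun d f (circlePt x)).re] := by
  have hP : maxP d f x = ((f.eval x : ℝ) : ℂ) +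
      Complex.I * √(alpha d f) * (eFun d f (circlePt x)).re := by
    rw [maxP, maxPIm, conj_eFun d f hx, Complex.add_conj]
    push_cast
    ring
  have hQ : Complex.I * maxQ d f x * (√(1 - x ^ 2) : ℝ) =
      Complex.I * √(alpha d f) * (eFun d f (circlePt x)).im := by
    rw [maxQ, conj_eFun d f hx, Complex.sub_conj]
    -- At `x = ±1` the quotient in `maxQ` is meaningless, but the factor `√(1 - x²)` kills it, and
    -- `e` is real there.
    by_cases hs : √(1 - x ^ 2) = 0
    · have hreal : (starRingEnd ℂ) (circlePt x) = circlePt x := by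
        rw [Complex.conj_eq_iff_im, circlePt_im, hs]
      have him : (eFun d f (circlePt x)).im = 0 := by
        rw [← Complex.conj_eq_iff_im, ← conj_eFun d f hx, inv_circlePt hx, hreal]
      simp [hs, him]
    · have hs' : ((√(1 - x ^ 2) : ℝ) : ℂ) ≠ 0 := by exact_mod_cast hs
      field_simp
      push_cast
      ring
  rw [h.qspU_eq x hx, hP, hQ]
  congr 1
  simp [sub_eq_add_neg]

theorem qspG_eq (h : IsMaximalSolution d f Φ) {x : ℝ} (hx : x ∈ Set.Icc (-1 : ℝ) 1) :
    qspG d x Φ = f.eval x := by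
  rw [qspG, h.qspU_apply hx]
  simp

theorem alpha_mul_eFun_mul_conj (h : IsMaximalSolution d f Φ) {x : ℝ}
    (hx : x ∈ Set.Icc (-1 : ℝ) 1) :
    (√(alpha d f) : ℂ) ^ 2 * (eFun d f (circlePt x) * eFun d f (circlePt x)⁻¹) =
      1 - ((f.eval x : ℝ) : ℂ) ^ 2 := by
  have hU := Matrix.mem_unitaryGroup_iff.mp (qspU_mem_unitary d x hx Φ)
  have h00 := congrFun (congrFun hU 0) 0
  rw [h.qspU_apply hx] at h00
  simp [Matrix.mul_apply, Fin.sum_univ_two, Matrix.star_apply] at h00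
  rw [conj_eFun d f hx, Complex.mul_conj, Complex.normSq_apply]
  push_cast
  linear_combination h00 + (√(alpha d f) : ℂ) ^ 2 * ((eFun d f (circlePt x)).re ^ 2 +
    (eFun d f (circlePt x)).im ^ 2) * Complex.I_sq

theorem eval_circlePt_rootPoly {x : ℝ} (hx : x ∈ Set.Icc (-1 : ℝ) 1) :
    (rootPoly d f).eval (circlePt x) = circlePt x ^ d * eFun d f (circlePt x) := by
  have := pow_ne_zero d (circlePt_ne_zero hx)
  rw [eFun, ← eval_rootPoly]
  field_simp

theorem eval_circlePt_revRootPoly {x : ℝ} (hx : x ∈ Set.Icc (-1 : ℝ) 1) :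
    circlePt x ^ d * (revRootPoly d f).eval (circlePt x) =
      circlePt x ^ Multiset.card (innerRoots d f) * eFun d f (circlePt x)⁻¹ := by
  have h0 := circlePt_ne_zero hx
  rw [eval_revRootPoly_eq d f h0, eFun, ← eval_rootPoly, inv_pow, inv_inv]
  ring

/-- The factorization of `𝔉`, obtained from unitarity of `U` on the arc. The powers of `z` stay on
both sides because the number of inner roots is not yet known. -/
theorem rootPoly_mul_revRootPoly (h : IsMaximalSolution d f Φ) (hf : f.natDegree ≤ d) :
    C ((√(alpha d f) : ℂ) ^ 2) * X ^ (2 * d) * (rootPoly d f * revRootPoly d f) =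
      X ^ Multiset.card (innerRoots d f) * laurentPoly d f := by
  refine eq_of_eval_circlePt_eq fun x hx => ?_
  have hnorm : ‖circlePt x‖ = 1 := by
    have := normSq_circlePt hx
    rw [Complex.normSq_eq_norm_sq] at this
    exact (pow_eq_one_iff_of_nonneg (norm_nonneg _) two_ne_zero).mp this
  have h1 := h.alpha_mul_eFun_mul_conj hx
  have h2 := eval_circlePt_rootPoly (d := d) (f := f) hx
  have h3 := eval_circlePt_revRootPoly (d := d) (f := f) hx
  simp only [eval_mul, eval_C, eval_pow, eval_X, eval_laurentPoly_circle hf hnorm, circlePt_re]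
  push_cast
  rw [← h1, h2]
  linear_combination (√(alpha d f) : ℂ) ^ 2 * circlePt x ^ (2 * d) *
    eFun d f (circlePt x) * h3

/-- If `√α` were `0`, unitarity at `x = 0` would force `f(0)² = 1`. -/
theorem sqrt_alpha_pos (h : IsMaximalSolution d f Φ) (hf : f.eval 0 ^ 2 < 1) :
    0 < √(alpha d f) := by
  refine (Real.sqrt_nonneg _).lt_of_ne' fun h0 => ?_
  have h1 := h.alpha_mul_eFun_mul_conj (x := 0) (by norm_num)
  rw [h0] at h1
  simp only [Complex.ofReal_zero, ne_eq, OfNat.ofNat_ne_zero, not_false_eq_true, zero_pow,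
    zero_mul] at h1
  have h2 : (1 : ℝ) - f.eval 0 ^ 2 = 0 := by exact_mod_cast h1.symm
  linarith

/-- Compare the orders of vanishing at `0` in the factorization: all factors other than the powers
of `z` are nonzero there. -/
theorem card_innerRoots (h : IsMaximalSolution d f Φ) (hd : 1 ≤ d) (hf : f.degree = d)
    (hα : 0 < √(alpha d f)) : Multiset.card (innerRoots d f) = 2 * d := by
  have key := h.rootPoly_mul_revRootPoly (natDegree_le_of_degree_le hf.le)
  have hs : (√(alpha d f) : ℂ) ^ 2 ≠ 0 := pow_ne_zero _ (by exact_mod_cast hα.ne')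
  have hq := eval_zero_rootPoly_ne_zero hd hf
  have hL := eval_zero_laurentPoly_ne_zero hd hf
  rcases lt_trichotomy (Multiset.card (innerRoots d f)) (2 * d) with hlt | heq | hgt
  · obtain ⟨m, hm⟩ := Nat.exists_eq_add_of_lt hlt
    have e : X ^ Multiset.card (innerRoots d f) * (C ((√(alpha d f) : ℂ) ^ 2) * X ^ (m + 1) *
        (rootPoly d f * revRootPoly d f)) =
        X ^ Multiset.card (innerRoots d f) * laurentPoly d f := by
      rw [← key, hm]
      ring
    have e0 := congrArg (eval 0) (mul_left_cancel₀ (pow_ne_zero _ X_ne_zero) e)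
    simp at e0
    exact absurd e0.symm hL
  · exact heq
  · obtain ⟨m, hm⟩ := Nat.exists_eq_add_of_lt hgt
    have e : X ^ (2 * d) * (C ((√(alpha d f) : ℂ) ^ 2) * (rootPoly d f * revRootPoly d f)) =
        X ^ (2 * d) * (X ^ (m + 1) * laurentPoly d f) := by
      rw [hm] at key
      linear_combination key
    have e0 := congrArg (eval 0) (mul_left_cancel₀ (pow_ne_zero _ X_ne_zero) e)
    simp only [eval_mul, eval_C, eval_pow, eval_X, zero_pow (Nat.succ_ne_zero m), zero_mul,
      eval_zero_revRootPoly, mul_one] at e0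
    exact absurd e0 (mul_ne_zero hs hq)

/-- On the circle `α |∏(1 - rz)|² = 1 - f² ≥ m²`, so `m/√α` bounds the product from below there,
hence also at `0`, where it is 1. -/
theorem le_sqrt_alpha (h : IsMaximalSolution d f Φ) (hf : f.natDegree ≤ d)
    (hα : 0 < √(alpha d f)) {m : ℝ} (hm : 0 < m)
    (hfm : ∀ x ∈ Set.Icc (-1 : ℝ) 1, m ^ 2 ≤ 1 - f.eval x ^ 2) : m ≤ √(alpha d f) := by
  have key := h.rootPoly_mul_revRootPoly hf
  have hc : m / √(alpha d f) ≤ 1 := by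
    refine one_le_of_le_norm_revRootPoly (d := d) (f := f) (div_pos hm hα) fun z hz => ?_
    have hz0 : z ≠ 0 := fun h => by simp [h] at hz
    have hinv : z⁻¹ = (starRingEnd ℂ) z := by
      rw [Complex.inv_def, Complex.normSq_eq_norm_sq, hz]; simp
    have hqw : ‖(rootPoly d f).eval z‖ = ‖(revRootPoly d f).eval z‖ := by
      rw [eval_revRootPoly_eq d f hz0, hinv, ← conj_eval_rootPoly]
      simp [hz]
    have hre : z.re ∈ Set.Icc (-1 : ℝ) 1 := by
      have := abs_le.mp (Complex.abs_re_le_norm z)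
      rwa [hz] at this
    have e := congrArg (fun p => ‖eval z p‖) key
    simp only [eval_mul, eval_C, eval_pow, eval_X, eval_laurentPoly_circle hf hz, norm_mul,
      norm_pow, hz, hqw, one_pow, mul_one, one_mul, Complex.norm_real, Real.norm_eq_abs,
      abs_of_pos hα] at e
    have h1 := hfm _ hre
    rw [abs_of_nonneg (by nlinarith [sq_nonneg m])] at e
    rw [div_le_iff₀ hα]
    refine (sq_le_sq₀ hm.le (mul_nonneg (norm_nonneg _) hα.le)).mp ?_
    nlinarith
  rwa [div_le_one hα] at hc

theorem hadamardConj_qspU (h : IsMaximalSolution d f Φ) {x : ℝ} (hx : x ∈ Set.Icc (-1 : ℝ) 1) :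
    hadamardConj (qspU d x Φ) 0 1 = Complex.I * √(alpha d f) *
      ((eFun d f (circlePt x) + eFun d f (circlePt x)⁻¹) / 2) ∧
    hadamardConj (qspU d x Φ) 1 1 - hadamardConj (qspU d x Φ) 0 0 =
      -(√(alpha d f) * (eFun d f (circlePt x) - eFun d f (circlePt x)⁻¹)) := by
  rw [hadamardConj_eq, h.qspU_apply hx, conj_eFun d f hx, Complex.add_conj, Complex.sub_conj]
  constructor
  · simp; ring
  · simp; ring

theorem polyU_zero_one (h : IsMaximalSolution d f Φ)
    (hn : Multiset.card (innerRoots d f) = 2 * d) :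
    C (-Complex.I) * polyU d Φ 0 1 =
      C (√(alpha d f) / 2 : ℂ) * (rootPoly d f + revRootPoly d f) := by
  refine eq_of_eval_circlePt_eq fun x hx => ?_
  have h1 := congrFun (congrFun (map_eval_circlePt_polyU d Φ hx) 0) 1
  have h2 := eval_circlePt_rootPoly (d := d) (f := f) hx
  have h3 := eval_circlePt_revRootPoly (d := d) (f := f) hx
  rw [hn, two_mul, pow_add, mul_assoc] at h3
  replace h3 := mul_left_cancel₀ (pow_ne_zero d (circlePt_ne_zero hx)) h3
  simp only [Matrix.map_apply, Matrix.smul_apply, smul_eq_mul, (h.hadamardConj_qspU hx).1] at h1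
  simp only [eval_mul, eval_C, eval_add, h1, h2, h3]
  linear_combination -(circlePt x ^ d * √(alpha d f) *
    ((eFun d f (circlePt x) + eFun d f (circlePt x)⁻¹) / 2)) * Complex.I_sq

/-- This combination cancels `∏(z - r)` and keeps `∏(1 - rz)`, whose constant term is known to be 1.
-/
theorem polyU_combination (h : IsMaximalSolution d f Φ)
    (hn : Multiset.card (innerRoots d f) = 2 * d) :
    C (-Complex.I) * polyU d Φ 0 1 + C (1 / 2) * (polyU d Φ 1 1 - polyU d Φ 0 0) =
      C (√(alpha d f) : ℂ) * revRootPoly d f := by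
  rw [h.polyU_zero_one hn]
  refine eq_of_eval_circlePt_eq fun x hx => ?_
  have h0 := congrFun (congrFun (map_eval_circlePt_polyU d Φ hx) 0) 0
  have h1 := congrFun (congrFun (map_eval_circlePt_polyU d Φ hx) 1) 1
  have h2 := eval_circlePt_rootPoly (d := d) (f := f) hx
  have h3 := eval_circlePt_revRootPoly (d := d) (f := f) hx
  rw [hn, two_mul, pow_add, mul_assoc] at h3
  replace h3 := mul_left_cancel₀ (pow_ne_zero d (circlePt_ne_zero hx)) h3
  simp only [Matrix.map_apply, Matrix.smul_apply, smul_eq_mul] at h0 h1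
  simp only [eval_mul, eval_C, eval_add, eval_sub, h0, h1, h2, h3]
  linear_combination circlePt x ^ d / 2 * (h.hadamardConj_qspU hx).2

end IsMaximalSolution

/-! ### The maximal phase factors are close to those of the zero polynomial -/

theorem one_add_sum_le_prod_one_add {ι : Type*} (s : Finset ι) {a : ι → ℝ}
    (ha : ∀ i ∈ s, 0 ≤ a i) : 1 + ∑ i ∈ s, a i ≤ ∏ i ∈ s, (1 + a i) := by
  classical
  induction s using Finset.induction_on with
  | empty => simp
  | insert i s hi ih =>
    rw [Finset.sum_insert hi, Finset.prod_insert hi]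
    have h0 := ha i (Finset.mem_insert_self i s)
    have h1 := ih fun j hj => ha j (Finset.mem_insert_of_mem hj)
    have h2 : 0 ≤ ∑ j ∈ s, a j :=
      Finset.sum_nonneg fun j hj => ha j (Finset.mem_insert_of_mem hj)
    nlinarith

namespace IsMaximalSolution

variable {m : ℕ} {f : ℝ[X]} {Φ : Fin (m + 2) → ℝ}

/-- The two relations come from the constant terms in `z`. -/
theorem sqrt_alpha_eq (h : IsMaximalSolution (m + 1) f Φ)
    (hn : Multiset.card (innerRoots (m + 1) f) = 2 * (m + 1)) :
    (∏ j : Fin m, Real.cos (Φ j.castSucc.succ)) * (Real.sin (Φ 0) * Real.cos (Φ 0)) =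
      √(alpha (m + 1) f) / 2 * (((rootPoly (m + 1) f).eval 0).re + 1) ∧
    (∏ j : Fin m, Real.cos (Φ j.castSucc.succ)) * (Real.sin (Φ 0) * Real.cos (Φ 0) + 1 / 2) =
      √(alpha (m + 1) f) := by
  have hlast : Φ (Fin.last (m + 1)) = Φ 0 := by
    rw [← h.symm 0, Fin.rev_zero]
  have hrow1 := eval_zero_polyU_row_one m fun j => Φ j.succ
  have hrow1' := (eval_zero_polyU_row_one (m + 1) Φ).2
  simp only [Fin.succ_last, hlast] at hrow1
  rw [hlast, Fin.prod_univ_succ] at hrow1'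
  simp only [Fin.castSucc_zero, ← Fin.succ_castSucc] at hrow1'
  have h00 := eval_zero_polyU_row_zero m Φ 0
  have h01 := eval_zero_polyU_row_zero m Φ 1
  rw [hrow1.1] at h00
  rw [hrow1.2] at h01
  have e1 := congrArg (eval 0) (h.polyU_zero_one hn)
  have e2 := congrArg (eval 0) (h.polyU_combination hn)
  simp only [eval_mul, eval_add, eval_sub, eval_C, h00, h01, hrow1', eval_zero_revRootPoly,
    ← Complex.ofReal_cos, ← Complex.ofReal_sin, ← Complex.ofReal_prod] at e1 e2
  set P := ∏ j : Fin m, Real.cos (Φ j.castSucc.succ)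
  constructor
  · have e3 : ((P * (Real.sin (Φ 0) * Real.cos (Φ 0)) : ℝ) : ℂ) =
        ((√(alpha (m + 1) f) / 2 : ℝ) : ℂ) * ((rootPoly (m + 1) f).eval 0 + 1) := by
      push_cast at e1 ⊢
      linear_combination e1 + P * (Complex.sin (Φ 0) * Complex.cos (Φ 0)) * Complex.I_sq
    have := congrArg Complex.re e3
    rwa [Complex.ofReal_re, Complex.re_ofReal_mul, Complex.add_re, Complex.one_re] at this
  · have hcs : (Complex.sin (Φ 0)) ^ 2 + (Complex.cos (Φ 0)) ^ 2 = 1 :=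
      Complex.sin_sq_add_cos_sq _
    have : ((P * (Real.sin (Φ 0) * Real.cos (Φ 0) + 1 / 2) : ℝ) : ℂ) =
        (√(alpha (m + 1) f) : ℂ) := by
      push_cast at e2 ⊢
      linear_combination e2 + (P * (Complex.sin (Φ 0) * Complex.cos (Φ 0)) +
        P / 2 * Complex.sin (Φ 0) ^ 2) * Complex.I_sq - P / 2 * hcs
    exact_mod_cast this

theorem basePhase_succ_castSucc (m : ℕ) (j : Fin m) : basePhase (m + 1) j.castSucc.succ = 0 := by
  have h1 : j.castSucc.succ ≠ Fin.last (m + 1) := by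
    rw [← Fin.succ_last, Ne, Fin.succ_inj]
    exact (Fin.castSucc_lt_last j).ne
  rw [basePhase, Pi.add_apply, Pi.single_eq_of_ne h1, Pi.single_eq_of_ne (Fin.succ_ne_zero _),
    add_zero]

theorem basePhase_zero (m : ℕ) : basePhase (m + 1) 0 = Real.pi / 4 := by
  rw [basePhase, Pi.add_apply, Pi.single_eq_same, ← Fin.succ_last,
    Pi.single_eq_of_ne (Fin.succ_ne_zero _).symm, zero_add]

theorem basePhase_last (m : ℕ) : basePhase (m + 1) (Fin.last (m + 1)) = Real.pi / 4 := by
  rw [basePhase, Pi.add_apply, Pi.single_eq_same, ← Fin.succ_last,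
    Pi.single_eq_of_ne (Fin.succ_ne_zero _), add_zero]

/-- The two equal end phases give `cos²(φ₀ - π/4) = sin φ₀ cos φ₀ + 1/2`, which is the second
constant-term relation. -/
theorem prod_cos_sub_basePhase (h : IsMaximalSolution (m + 1) f Φ)
    (hn : Multiset.card (innerRoots (m + 1) f) = 2 * (m + 1)) :
    ∏ j, Real.cos (Φ j - basePhase (m + 1) j) = √(alpha (m + 1) f) := by
  have hlast : Φ (Fin.last (m + 1)) = Φ 0 := by
    rw [← h.symm 0, Fin.rev_zero]
  have hsq : Real.cos (Φ 0 - Real.pi / 4) * Real.cos (Φ 0 - Real.pi / 4) =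
      Real.sin (Φ 0) * Real.cos (Φ 0) + 1 / 2 := by
    rw [Real.cos_sub, Real.cos_pi_div_four, Real.sin_pi_div_four]
    have h2 : √2 * √2 = (2 : ℝ) := Real.mul_self_sqrt (by norm_num)
    linear_combination (Real.cos (Φ 0) + Real.sin (Φ 0)) ^ 2 / 4 * h2 +
      1 / 2 * Real.sin_sq_add_cos_sq (Φ 0)
  rw [Fin.prod_univ_succ, Fin.prod_univ_castSucc, ← (h.sqrt_alpha_eq hn).2, ← hsq]
  simp only [basePhase_succ_castSucc, basePhase_zero, Fin.succ_last, basePhase_last, hlast,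
    sub_zero]
  ring

/-- The domain handles the inner phases off the middle. For the ends, `sin φ₀ cos φ₀ > 0` is needed
to place `φ₀` in the first quadrant. -/
theorem cos_sub_basePhase_nonneg (h : IsMaximalSolution (m + 1) f Φ)
    (hn : Multiset.card (innerRoots (m + 1) f) = 2 * (m + 1)) (hα : 0 < √(alpha (m + 1) f))
    (j : Fin (m + 2)) :
    |Φ j - basePhase (m + 1) j| ≤ 3 * Real.pi / 2 ∧ 0 ≤ Real.cos (Φ j - basePhase (m + 1) j) := by
  have hπ := Real.pi_pos
  have hlast : Φ (Fin.last (m + 1)) = Φ 0 := by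
    rw [← h.symm 0, Fin.rev_zero]
  have hdom : ∀ j : Fin (m + 2), 2 * (j : ℕ) ≠ m + 1 →
      Φ j ∈ Set.Ico (-(Real.pi / 2)) (Real.pi / 2) := by
    intro j hj
    simpa [hj] using h.mem_domain j
  obtain ⟨e1, e2⟩ := h.sqrt_alpha_eq hn
  set P := ∏ j : Fin m, Real.cos (Φ j.castSucc.succ)
  have h0 : Φ 0 ∈ Set.Ioo 0 (Real.pi / 2) := by
    have hd0 := hdom 0 (by simp)
    have hsc : 0 ≤ Real.sin (Φ 0) * Real.cos (Φ 0) + 1 / 2 := by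
      nlinarith [Real.sin_sq_add_cos_sq (Φ 0), sq_nonneg (Real.sin (Φ 0) + Real.cos (Φ 0))]
    have hP : 0 < P := pos_of_mul_pos_left (e2 ▸ hα) hsc
    have hne : innerRoots (m + 1) f ≠ 0 := fun h => by simp [h] at hn
    -- Here `|∏ r| < 1` enters: it makes the first constant-term relation strictly positive.
    have hre : 0 < ((rootPoly (m + 1) f).eval 0).re + 1 := by
      have := (abs_lt.mp ((Complex.abs_re_le_norm _).trans_lt
        (norm_eval_zero_rootPoly_lt_one hne))).1
      linarith
    have hpos : 0 < Real.sin (Φ 0) * Real.cos (Φ 0) :=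
      pos_of_mul_pos_right (e1 ▸ by positivity) hP.le
    have hc : 0 ≤ Real.cos (Φ 0) := Real.cos_nonneg_of_mem_Icc ⟨hd0.1, hd0.2.le⟩
    refine ⟨?_, hd0.2⟩
    by_contra hle
    have : Real.sin (Φ 0) ≤ 0 :=
      Real.sin_nonpos_of_nonpos_of_neg_pi_le (not_lt.mp hle) (by linarith [hd0.1])
    nlinarith
  have hend : |Φ 0 - Real.pi / 4| ≤ Real.pi / 2 := by
    rw [abs_le]
    constructor <;> linarith [h0.1, h0.2]
  have hnonmid : ∀ j : Fin (m + 2), 2 * (j : ℕ) ≠ m + 1 →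
      |Φ j - basePhase (m + 1) j| ≤ Real.pi / 2 := by
    intro j hj
    refine Fin.cases (motive := fun j => 2 * (j : ℕ) ≠ m + 1 →
      |Φ j - basePhase (m + 1) j| ≤ Real.pi / 2) ?_ (fun i => ?_) j hj
    · intro _
      rwa [basePhase_zero]
    · refine Fin.lastCases ?_ (fun i hi => ?_) i
      · intro _
        rwa [Fin.succ_last, basePhase_last, hlast]
      · have := hdom _ hi
        rw [basePhase_succ_castSucc, sub_zero, abs_le]
        exact ⟨this.1, this.2.le⟩
  have hcos : ∀ j : Fin (m + 2), 2 * (j : ℕ) ≠ m + 1 →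
      0 ≤ Real.cos (Φ j - basePhase (m + 1) j) := fun j hj =>
    Real.cos_nonneg_of_mem_Icc (abs_le.mp (hnonmid j hj))
  by_cases hj : 2 * (j : ℕ) = m + 1
  · have hmid : j.val ≠ 0 ∧ j.val ≠ m + 1 := by omega
    have hbase : basePhase (m + 1) j = 0 := by
      rw [basePhase, Pi.add_apply, Pi.single_eq_of_ne, Pi.single_eq_of_ne, add_zero]
      · exact fun e => hmid.1 (by rw [e]; rfl)
      · exact fun e => hmid.2 (by rw [e]; rfl)
    constructor
    · have := h.mem_domain j
      rw [if_pos hj] at this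
      rw [hbase, sub_zero, abs_le]
      constructor <;> linarith [this.1, this.2]
    · have hprod := h.prod_cos_sub_basePhase hn
      rw [← Finset.mul_prod_erase _ _ (Finset.mem_univ j)] at hprod
      -- The middle phase ranges over a full period; its cosine has the right sign because the whole
      -- product and the other factors do.
      refine (pos_of_mul_pos_left (hprod ▸ hα) (Finset.prod_nonneg fun l hl => hcos l ?_)).le
      intro hl2
      exact (Finset.ne_of_mem_erase hl) (Fin.ext (by omega))
  · exact ⟨(hnonmid j hj).trans (by linarith), hcos j hj⟩

theorem sum_sq_sub_basePhase_le (h : IsMaximalSolution (m + 1) f Φ)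
    (hn : Multiset.card (innerRoots (m + 1) f) = 2 * (m + 1)) (hα : 0 < √(alpha (m + 1) f)) :
    √(alpha (m + 1) f) ^ 2 * (1 + ∑ j, (Φ j - basePhase (m + 1) j) ^ 2) ≤ 1 := by
  have hsum : 1 + ∑ j, (Φ j - basePhase (m + 1) j) ^ 2 ≤
      ∏ j, (1 + (Φ j - basePhase (m + 1) j) ^ 2) :=
    one_add_sum_le_prod_one_add _ fun j _ => sq_nonneg _
  calc _ ≤ √(alpha (m + 1) f) ^ 2 * ∏ j, (1 + (Φ j - basePhase (m + 1) j) ^ 2) := by gcongr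
    _ = ∏ j, (Real.cos (Φ j - basePhase (m + 1) j) ^ 2 *
          (1 + (Φ j - basePhase (m + 1) j) ^ 2)) := by
        rw [← h.prod_cos_sub_basePhase hn, Finset.prod_mul_distrib, Finset.prod_pow]
    _ ≤ 1 := by
        refine Finset.prod_le_one (fun j _ => by positivity) fun j _ => ?_
        obtain ⟨habs, hcos⟩ := h.cos_sub_basePhase_nonneg hn hα j
        set x := Φ j - basePhase (m + 1) j
        -- Valid up to `3π/2`, hence also for a middle phase in `[-π, π)`; squaring needs `cos x ≥
        -- 0`.
        have hb := Real.cos_le_one_div_sqrt_sq_add_one (x := x)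
          (by linarith [(abs_le.mp habs).1]) (abs_le.mp habs).2
        have h1 : 0 < x ^ 2 + 1 := by positivity
        calc Real.cos x ^ 2 * (1 + x ^ 2) ≤ (1 / √(x ^ 2 + 1)) ^ 2 * (1 + x ^ 2) := by gcongr
          _ = 1 := by
            rw [div_pow, Real.sq_sqrt h1.le, one_pow, add_comm 1, one_div,
              inv_mul_cancel₀ h1.ne']

end IsMaximalSolution

/-! ### The sup norm and the final estimate. -/

theorem abs_eval_le_supNorm (f : ℝ[X]) {x : ℝ} (hx : x ∈ Set.Icc (-1 : ℝ) 1) :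
    |f.eval x| ≤ supNorm f :=
  le_csSup (isCompact_Icc.image (by fun_prop : Continuous fun x : ℝ => |f.eval x|)).bddAbove
    ⟨x, hx, rfl⟩

end SymQSP

theorem mainTheorem8 (d : ℕ) (hd : 1 ≤ d) (f : Polynomial ℝ) (hf : SymQSP.IsTarget d f)
    (hbound : SymQSP.supNorm f ≤ √3 / (20 * Real.pi * (SymQSP.dTilde d : ℝ)))
    (Φ : Fin (d + 1) → ℝ) (hΦ : SymQSP.IsMaximalSolution d f Φ) :
    ∃ hpos : (SymQSP.hessian (SymQSP.cost d f) (SymQSP.reduced Φ)).PosDef,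
      (32 / 25 : ℝ) ≤ SymQSP.lambdaMin hpos.isHermitian := by
  obtain ⟨m, rfl⟩ : ∃ m, d = m + 1 := ⟨d - 1, by omega⟩
  refine SymQSP.hessian_posDef_of_near_basePhase (m + 1) f hΦ.symm (fun x hx => hΦ.qspG_eq hx) ?_
  set ε := SymQSP.supNorm f with hε
  have hε0 : 0 ≤ ε := (abs_nonneg _).trans (SymQSP.abs_eval_le_supNorm f (x := 0) (by norm_num))
  -- From `d + 1 ≤ 2d̃` the left side is at most `√3/(10π)`, and `√3 < π`.
  have hεN : ε * (((m + 1 : ℕ) : ℝ) + 1) ≤ 1 / 10 := by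
    have hN : (((m + 1 : ℕ) : ℝ) + 1) ≤ 2 * (SymQSP.dTilde (m + 1) : ℝ) := by
      have : m + 1 + 1 ≤ 2 * SymQSP.dTilde (m + 1) := by unfold SymQSP.dTilde; omega
      exact_mod_cast this
    have hN0 : (0 : ℝ) < SymQSP.dTilde (m + 1) := by
      exact_mod_cast Nat.succ_pos _
    have h3 : √3 ≤ (2 : ℝ) := Real.sqrt_le_iff.mpr (by norm_num)
    have hπ := Real.pi_gt_three
    rw [le_div_iff₀ (by positivity)] at hbound
    have h1 : 3 * (ε * SymQSP.dTilde (m + 1)) ≤ Real.pi * (ε * SymQSP.dTilde (m + 1)) := by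
      gcongr
    nlinarith [mul_le_mul_of_nonneg_left hN hε0]
  have hε1 : ε ≤ 1 / 20 := by
    have : (2 : ℝ) ≤ ((m + 1 : ℕ) : ℝ) + 1 := by push_cast; linarith [Nat.cast_nonneg (α := ℝ) m]
    nlinarith
  have hfsq : ∀ x ∈ Set.Icc (-1 : ℝ) 1, f.eval x ^ 2 ≤ ε ^ 2 := fun x hx => by
    rw [← sq_abs]
    exact pow_le_pow_left₀ (abs_nonneg _) (SymQSP.abs_eval_le_supNorm f hx) 2
  have hα : 0 < √(SymQSP.alpha (m + 1) f) :=
    hΦ.sqrt_alpha_pos (by nlinarith [hfsq 0 (by norm_num)])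
  have hn := hΦ.card_innerRoots hd hf.degree_eq hα
  have hsum := hΦ.sum_sq_sub_basePhase_le hn hα
  have h1ε : 0 < 1 - ε ^ 2 := by nlinarith
  have hlow := hΦ.le_sqrt_alpha (Polynomial.natDegree_le_of_degree_le hf.degree_eq.le) hα
    (Real.sqrt_pos.mpr h1ε) fun x hx => by
      rw [Real.sq_sqrt h1ε.le]
      linarith [hfsq x hx]
  have hlow2 : 1 - ε ^ 2 ≤ √(SymQSP.alpha (m + 1) f) ^ 2 := by
    rw [← Real.sq_sqrt h1ε.le]
    exact pow_le_pow_left₀ (Real.sqrt_nonneg _) hlow 2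
  set S := ∑ j, (Φ j - SymQSP.basePhase (m + 1) j) ^ 2
  have hS0 : 0 ≤ S := Finset.sum_nonneg fun j _ => sq_nonneg _
  -- Indeed `S ≤ ε²/(1 - ε²)`, and `ε² ≤ 1/2`.
  have hS : S ≤ 2 * ε ^ 2 := by
    have : (1 - ε ^ 2) * (1 + S) ≤ 1 := (mul_le_mul_of_nonneg_right hlow2 (by linarith)).trans hsum
    nlinarith [mul_nonneg hS0 (by nlinarith : 0 ≤ 1 / 2 - ε ^ 2)]
  calc (((m + 1 : ℕ) : ℝ) + 1) ^ 2 * S ≤ (((m + 1 : ℕ) : ℝ) + 1) ^ 2 * (2 * ε ^ 2) := by gcongr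
    _ = 2 * (ε * (((m + 1 : ℕ) : ℝ) + 1)) ^ 2 := by ring
    _ ≤ 2 * (1 / 10) ^ 2 := by gcongr
    _ ≤ 1 / 25 := by norm_num
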